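/- Let $M=(|M|,\mathcal O_M)$ be a smooth (Hausdorff) supermanifold of dimension $p|q$, i.e. a Hausdorff topological space with a sheaf of real commutative superalgebras that is locally isomorphic to $(\mathbb R^p, C^\infty_{\mathbb R^p}\otimes\Lambda(\theta_1,\dots,\theta_q))$. Let $A$ be a real super Weil algebra: a finite-dimensional commutative unital superalgebra $A=\mathbb R\oplus N$ with $N$ a nilpotent graded ideal of codimension one. Let $x\in|M|$ and let $x_A:\mathcal O_{M,x}\to A$ be an $A$-point of $M$ with base point $x$, i.e. a morphism of superalgebras; for every open $U\ni x$ write $x_A(s)$ also for $x_A$ of the germ at $x$ of $s\in\mathcal O_M(U)$. For an open $U\ni x$ let $\mathrm{Der}_{x_A}(\mathcal O_M(U),A)$ be the left $A$-module, with $(aX)(s)=aX(s)$, of all sums of an even and an odd linear map $X:\mathcal O_M(U)\to A$ with $X(st)=X(s)\,x_A(t)+(-1)^{|X||s|}x_A(s)\,X(t)$ for homogeneous $s$ and all $t$. Let $T_x(M)$ be the tangent superspace, i.e. the space of all (sums of an even and an odd) superderivations $\mathcal O_{M,x}\to\mathbb R$ along the evaluation $\mathrm{ev}_x$. Let $\mathcal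 T_{M,x}$ be the left $\mathcal O_{M,x}$-module of germs at $x$ of vector fields, i.e. the stalk of $\mathcal T_M=\mathrm{Der}(\mathcal O_M)$, and let $A\otimes_{x_A}\mathcal T_{M,x}$ be the quotient of $A\otimes_{\mathbb R}\mathcal T_{M,x}$ by the relations $a\otimes b\,\xi=a\,x_A(b)\otimes\xi$ ($a\in A$, $b\in\mathcal O_{M,x}$, $\xi\in\mathcal T_{M,x}$). Then there are isomorphisms of left $A$-modules $$\mathrm{Der}_{x_A}(\mathcal O(M),A)\;\cong\;A\otimes_{\mathbb R} T_x(M)\;\cong\;A\otimes_{x_A}\mathcal T_{M,x},$$ and $a\otimes\xi\mapsto a\,(x_A\circ\xi)$ is an isomorphism $A\otimes_{x_A}\mathcal T_{M,x}\to\mathrm{Der}_{x_A}(\mathcal O(M),A)$. Moreover, for every chart of $M$ around $x$ with coordinates $x_1,\dots,x_p,\theta_1,\dots,\theta_q$ and every open $U\ni x$ (for instance $U=|M|$, or $U$ the domain of the chart): 1. there is an isomorphism of left $A$-modules $A\otimes_{\mathbb R} T_x(M)\to\mathrm{Der}_{x_A}(\mathcal O_M(U),A)$ with $a\otimes\frac{\partial}{\partial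 x_i}\big|_x\mapsto a\,x_A\circ\frac{\partial}{\partial x_i}$ and $a\otimes\frac{\partial}{\partial\theta_j}\big|_x\mapsto a\,x_A\circ\frac{\partial}{\partial\theta_j}$ for all $a\in A$ and all $i,j$; 2. for all $f_1,\dots,f_p,F_1,\dots,F_q\in A$ the map $$X_{\boldsymbol f}=\sum_{i} f_i\,x_A\circ\frac{\partial}{\partial x_i}+\sum_{j}F_j\,x_A\circ\frac{\partial}{\partial\theta_j}:\ \mathcal O_M(U)\to A$$ is an $x_A$-derivation; it is even (resp. odd) if and only if all $f_i$ are even (resp. odd) and all $F_j$ are odd (resp. even); 3. every element of $\mathrm{Der}_{x_A}(\mathcal O_M(U),A)$ is equal to $X_{\boldsymbol f}$ for a unique family $\boldsymbol f=(f_1,\dots,f_p,F_1,\dots,F_q)$. -/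

import Mathlib

open scoped Manifold ContDiff TensorProduct
open TopologicalSpace

universe u v w

noncomputable section

namespace SuperGeom

/-! ### Super vector spaces, commutative superalgebras, super Weil algebras -/

/-- A parity on a real vector space: the subspaces `par 0` (even) and `par 1` (odd). -/
class Parity (A : Type*) [AddCommGroup A] [Module ℝ A] where
  par : ZMod 2 → Submodule ℝ A

open Parity (par)

/-- The Koszul sign `(-1)^{ij}` of two parities. -/
def sgn (i j : ZMod 2) : ℝ := (-1) ^ (i.val * j.val)

/-- A (supercommutative, unital, real) superalgebra. -/
class CommSuperalgebra (A : Type*) [Ring A] [Algebra ℝ A] [Parity A] where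
  graded : GradedAlgebra (par : ZMod 2 → Submodule ℝ A)
  mul_comm : ∀ {i j : ZMod 2} {a b : A}, a ∈ par i → b ∈ par j → a * b = sgn i j • (b * a)

attribute [reducible, instance] CommSuperalgebra.graded

theorem parity_cases : ∀ i : ZMod 2, i = 0 ∨ i = 1 := by decide

/-- A real super Weil algebra: a finite dimensional commutative superalgebra
`A = ℝ ⊕ N`, with `N` a nilpotent graded ideal. -/
class SuperWeilAlgebra (A : Type*) [Ring A] [Algebra ℝ A] [Parity A] [CommSuperalgebra A] :
    Prop where
  nontrivial : Nontrivial A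
  finite : Module.Finite ℝ A
  exists_nil : ∃ N : Ideal A, N.IsTwoSided ∧ N.IsHomogeneous (par : ZMod 2 → Submodule ℝ A) ∧
    (∃ k : ℕ, (N.restrictScalars ℝ) ^ k = (⊥ : Submodule ℝ A)) ∧
    IsCompl (1 : Submodule ℝ A) (N.restrictScalars ℝ)

/-- The real numbers, purely even. -/
instance : Parity ℝ where
  par i := if i = 0 then ⊤ else ⊥

theorem par_real_zero : (par 0 : Submodule ℝ ℝ) = ⊤ := rfl

theorem par_real_one : (par 1 : Submodule ℝ ℝ) = ⊥ := rfl

instance : CommSuperalgebra ℝ where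
  graded :=
    { one_mem := trivial
      mul_mem := by
        intro i j a b ha hb
        rcases parity_cases i with rfl | rfl <;> rcases parity_cases j with rfl | rfl
        · trivial
        · rw [par_real_one, Submodule.mem_bot] at hb
          rw [hb, mul_zero]
          exact Submodule.zero_mem _
        · rw [par_real_one, Submodule.mem_bot] at ha
          rw [ha, zero_mul]
          exact Submodule.zero_mem _
        · trivial
      toDecomposition := by
        refine DirectSum.IsInternal.chooseDecomposition _ ?_
        refine (DirectSum.isInternal_submodule_iff_isCompl _ (i := 0) (j := 1) (by decide)
          (Set.eq_univ_of_forall parity_cases).symm).2 ?_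
        rw [par_real_zero, par_real_one]
        exact isCompl_top_bot }
  mul_comm := by
    intro i j a b ha hb
    rcases parity_cases i with rfl | rfl <;> rcases parity_cases j with rfl | rfl <;>
      simp_all [par_real_one, sgn, mul_comm]

/-- A morphism of superalgebras: an algebra morphism that preserves parity. -/
structure SuperHom (B A : Type*) [Ring B] [Algebra ℝ B] [Parity B] [Ring A] [Algebra ℝ A]
    [Parity A] extends B →ₐ[ℝ] A where
  map_par : ∀ (i : ZMod 2) (b : B), b ∈ par i → toAlgHom b ∈ par i

namespace SuperHom

variable {B A C : Type*} [Ring B] [Algebra ℝ B] [Parity B] [Ring A] [Algebra ℝ A] [Parity A]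
  [Ring C] [Algebra ℝ C] [Parity C]

instance : CoeFun (SuperHom B A) (fun _ => B → A) := ⟨fun φ => φ.toAlgHom⟩

/-- The identity morphism. -/
def id (B : Type*) [Ring B] [Algebra ℝ B] [Parity B] : SuperHom B B :=
  ⟨AlgHom.id ℝ B, fun _ _ h => h⟩

/-- Composition of morphisms. -/
def comp (ψ : SuperHom A C) (φ : SuperHom B A) : SuperHom B C :=
  ⟨ψ.toAlgHom.comp φ.toAlgHom, fun i b h => ψ.map_par i _ (φ.map_par i b h)⟩

end SuperHom

/-! ### Derivations along a morphism -/

section Derivations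

variable {B A : Type*} [Ring B] [Algebra ℝ B] [Parity B] [Ring A] [Algebra ℝ A] [Parity A]

/-- The linear maps `X : B → A` of parity `k` with
`X(st) = X(s) φ(t) + (-1)^{|X||s|} φ(s) X(t)` for homogeneous `s`. -/
def homogDer (φ : SuperHom B A) (k : ZMod 2) : Submodule ℝ (B →ₗ[ℝ] A) where
  carrier := {X | (∀ j, ∀ s ∈ (par j : Submodule ℝ B), X s ∈ par (j + k)) ∧
    ∀ j, ∀ s ∈ (par j : Submodule ℝ B), ∀ t, X (s * t) = X s * φ t + sgn k j • (φ s * X t)}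
  zero_mem' := ⟨fun _ _ _ => Submodule.zero_mem _, fun _ _ _ _ => by simp⟩
  add_mem' := by
    rintro X Y ⟨hX, hX'⟩ ⟨hY, hY'⟩
    refine ⟨fun j s hs => Submodule.add_mem _ (hX j s hs) (hY j s hs), fun j s hs t => ?_⟩
    simp only [LinearMap.add_apply, hX' j s hs t, hY' j s hs t, add_mul, mul_add, smul_add]
    abel
  smul_mem' := by
    rintro c X ⟨hX, hX'⟩
    refine ⟨fun j s hs => Submodule.smul_mem _ c (hX j s hs), fun j s hs t => ?_⟩
    simp only [LinearMap.smul_apply, hX' j s hs t, smul_add, smul_mul_assoc, mul_smul_comm,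
      smul_comm c]

variable [CommSuperalgebra A]

theorem smul_homogDer (φ : SuperHom B A) {i k : ZMod 2} {a : A} (ha : a ∈ par i)
    {X : B →ₗ[ℝ] A} (hX : X ∈ homogDer φ k) : a • X ∈ homogDer φ (k + i) := by
  refine ⟨fun j s hs => ?_, fun j s hs t => ?_⟩
  · have := SetLike.mul_mem_graded ha (hX.1 j s hs)
    rwa [show i + (j + k) = j + (k + i) by ring] at this
  · simp only [LinearMap.smul_apply, smul_eq_mul, hX.2 j s hs t, mul_add, ← mul_assoc,
      mul_smul_comm, CommSuperalgebra.mul_comm ha (φ.map_par j s hs), smul_mul_assoc, smul_smul]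
    congr 2
    rcases parity_cases i with rfl | rfl <;> rcases parity_cases j with rfl | rfl <;>
      rcases parity_cases k with rfl | rfl <;> simp [sgn, show (1 : ZMod 2) + 1 = 0 from rfl, ZMod.val_one]

/-- The left `A`-module `Der_φ(B, A)` of all `φ`-derivations `B → A`: the sums of an even and
an odd one; `A` acts by `(a X)(s) = a X(s)`. -/
def superDer (φ : SuperHom B A) : Submodule A (B →ₗ[ℝ] A) where
  carrier := {X | X ∈ homogDer φ 0 ⊔ homogDer φ 1}
  zero_mem' := (homogDer φ 0 ⊔ homogDer φ 1).zero_mem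
  add_mem' := (homogDer φ 0 ⊔ homogDer φ 1).add_mem
  smul_mem' := by
    intro a X hX
    obtain ⟨X₀, h₀, X₁, h₁, rfl⟩ := Submodule.mem_sup.1 hX
    have key : ∀ i, ∀ a ∈ (par i : Submodule ℝ A), a • (X₀ + X₁) ∈ homogDer φ 0 ⊔ homogDer φ 1 := by
      intro i a ha
      have e₀ := smul_homogDer φ ha h₀
      have e₁ := smul_homogDer φ ha h₁
      rw [smul_add]
      fin_cases i
      · exact Submodule.add_mem_sup e₀ e₁
      · rw [add_comm]
        exact Submodule.add_mem_sup e₁ e₀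
    show a • (X₀ + X₁) ∈ homogDer φ 0 ⊔ homogDer φ 1
    classical
    rw [← DirectSum.sum_support_decompose (par : ZMod 2 → Submodule ℝ A) a, Finset.sum_smul]
    exact Submodule.sum_mem _ fun i _ => key i _ (SetLike.coe_mem _)

end Derivations

/-- For a morphism `ρ : B → A` and a left `B`-module `L`, the tensor product `A ⊗_ρ L`: the
quotient of `A ⊗ L` by the relations `a ⊗ b l = a ρ(b) ⊗ l`, a left `A`-module. -/
def rhoRel {B A : Type*} [Ring B] [Algebra ℝ B] [Ring A] [Algebra ℝ A] (ρ : B →ₐ[ℝ] A)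
    (L : Type*) [AddCommGroup L] [Module ℝ L] [Module B L] : Submodule A (A ⊗[ℝ] L) :=
  Submodule.span A {z | ∃ (a : A) (b : B) (l : L), z = a ⊗ₜ[ℝ] (b • l) - (a * ρ b) ⊗ₜ[ℝ] l}

/-- The `ρ`-tensor product `A ⊗_ρ L`. -/
abbrev RhoTensor {B A : Type*} [Ring B] [Algebra ℝ B] [Ring A] [Algebra ℝ A] (ρ : B →ₐ[ℝ] A)
    (L : Type*) [AddCommGroup L] [Module ℝ L] [Module B L] : Type _ :=
  (A ⊗[ℝ] L) ⧸ rhoRel ρ L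

/-! ### The local model -/

/-- The real algebra `C^∞(U)` of smooth functions on an open set `U ⊆ ℝ^p`. -/
abbrev SmoothFun (p : ℕ) (U : Opens (EuclideanSpace ℝ (Fin p))) : Type :=
  C^∞⟮𝓘(ℝ, EuclideanSpace ℝ (Fin p)), U; 𝓘(ℝ, ℝ), ℝ⟯

/-- The Grassmann algebra `Λ(θ₁, …, θ_q)`. -/
abbrev Grassmann (q : ℕ) : Type := ExteriorAlgebra ℝ (Fin q → ℝ)

/-- The superalgebra `𝒪(U) = C^∞(U) ⊗ Λ(θ₁, …, θ_q)` of the superdomain `U ⊆ ℝ^{p|q}`. -/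
abbrev SuperFun (p q : ℕ) (U : Opens (EuclideanSpace ℝ (Fin p))) : Type :=
  SmoothFun p U ⊗[ℝ] Grassmann q

/-- The parity of `𝒪(U)` is that of the Grassmann algebra. -/
instance (p q : ℕ) (U : Opens (EuclideanSpace ℝ (Fin p))) : Parity (SuperFun p q U) where
  par i := LinearMap.range (LinearMap.lTensor (SmoothFun p U)
    (CliffordAlgebra.evenOdd (0 : QuadraticForm ℝ (Fin q → ℝ)) i).subtype)

section Model

variable {p q : ℕ} {U V W : Opens (EuclideanSpace ℝ (Fin p))}

/-- Restriction of smooth functions. -/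
def smoothRes (h : V ≤ U) : SmoothFun p U →ₐ[ℝ] SmoothFun p V :=
  { ContMDiffMap.restrictRingHom 𝓘(ℝ, EuclideanSpace ℝ (Fin p)) 𝓘(ℝ, ℝ) ℝ h with
    commutes' := fun _ => rfl }

/-- Restriction in the structure sheaf of `ℝ^{p|q}`. -/
def modelRes (q : ℕ) (h : V ≤ U) : SuperFun p q U →ₐ[ℝ] SuperFun p q V :=
  Algebra.TensorProduct.map (smoothRes h) (AlgHom.id ℝ (Grassmann q))

/-- The value at `u` of the reduction of a superfunction (all `θ_j` set to zero). -/
def modelEval (q : ℕ) (u : U) : SuperFun p q U →ₐ[ℝ] ℝ :=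
  Algebra.TensorProduct.lift
    ({ ContMDiffMap.evalRingHom u with commutes' := fun _ => rfl } : SmoothFun p U →ₐ[ℝ] ℝ)
    (ExteriorAlgebra.algebraMapInv : Grassmann q →ₐ[ℝ] ℝ) (fun _ _ => Commute.all _ _)

/-- Extension by zero of a function on `U` to `ℝ^p`. -/
def extendZero (f : SmoothFun p U) : EuclideanSpace ℝ (Fin p) → ℝ :=
  Function.extend Subtype.val f 0

theorem extendZero_apply (f : SmoothFun p U) (u : U) : extendZero f u = f u :=
  Subtype.val_injective.extend_apply _ _ _

theorem contDiffAt_extendZero (f : SmoothFun p U) (u : U) :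
    ContDiffAt ℝ ∞ (extendZero f) u := by
  rw [← contMDiffAt_iff_contDiffAt, ← contMDiffAt_subtype_iff]
  simp only [extendZero_apply]
  exact f.contMDiff u

/-- The partial derivative `∂f/∂x_i` of a smooth function on `U`. -/
def smoothPartialFun (i : Fin p) (f : SmoothFun p U) : SmoothFun p U :=
  ⟨fun u => fderiv ℝ (extendZero f) u (EuclideanSpace.single i 1), fun u =>
    (contMDiffAt_subtype_iff (f := fun y => fderiv ℝ (extendZero f) y
      (EuclideanSpace.single i 1))).2 <| contMDiffAt_iff_contDiffAt.2 <|
      ((contDiffAt_extendZero f u).fderiv_right (m := ∞) le_rfl).clm_apply contDiffAt_const⟩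

theorem smoothPartialFun_apply (i : Fin p) (f : SmoothFun p U) (u : U) :
    smoothPartialFun i f u = fderiv ℝ (extendZero f) u (EuclideanSpace.single i 1) := rfl

theorem differentiableAt_extendZero (f : SmoothFun p U) (u : U) :
    DifferentiableAt ℝ (extendZero f) u :=
  (contDiffAt_extendZero f u).differentiableAt (by simp)

theorem extendZero_eventuallyEq (f : SmoothFun p U) (g : EuclideanSpace ℝ (Fin p) → ℝ) (u : U)
    (h : ∃ V : Opens (EuclideanSpace ℝ (Fin p)), ∃ hV : V ≤ U, u.1 ∈ V ∧
      ∀ (y) (hy : y ∈ V), f ⟨y, hV hy⟩ = g y) :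
    extendZero f =ᶠ[nhds u.1] g := by
  obtain ⟨V, hV, hu, h⟩ := h
  filter_upwards [V.isOpen.mem_nhds hu] with y hy
  rw [← h y hy]
  exact extendZero_apply f ⟨y, hV hy⟩

/-- The partial derivative `∂/∂x_i` on `C^∞(U)`. -/
def smoothPartial (i : Fin p) : SmoothFun p U →ₗ[ℝ] SmoothFun p U where
  toFun := smoothPartialFun i
  map_add' f g := by
    ext u
    have : extendZero (f + g) =ᶠ[nhds u.1] extendZero f + extendZero g :=
      extendZero_eventuallyEq _ _ u ⟨U, le_rfl, u.2, fun y hy => by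
        simp [extendZero_apply _ (⟨y, hy⟩ : U)]⟩
    rw [ContMDiffMap.coe_add, Pi.add_apply]
    simp only [smoothPartialFun_apply]
    rw [this.fderiv_eq, fderiv_add (differentiableAt_extendZero f u)
      (differentiableAt_extendZero g u)]
    rfl
  map_smul' c f := by
    ext u
    have : extendZero (c • f) =ᶠ[nhds u.1] c • extendZero f :=
      extendZero_eventuallyEq _ _ u ⟨U, le_rfl, u.2, fun y hy => by
        simp [extendZero_apply _ (⟨y, hy⟩ : U)]⟩
    rw [ContMDiffMap.coe_smul, Pi.smul_apply]
    simp only [smoothPartialFun_apply]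
    rw [this.fderiv_eq, fderiv_const_smul (differentiableAt_extendZero f u)]
    rfl

theorem smoothPartial_apply (i : Fin p) (f : SmoothFun p U) (u : U) :
    smoothPartial i f u = fderiv ℝ (extendZero f) u (EuclideanSpace.single i 1) := rfl

theorem smoothPartial_mul (i : Fin p) (f g : SmoothFun p U) :
    smoothPartial i (f * g) = smoothPartial i f * g + f * smoothPartial i g := by
  ext u
  have : extendZero (f * g) =ᶠ[nhds u.1] extendZero f * extendZero g :=
    extendZero_eventuallyEq _ _ u ⟨U, le_rfl, u.2, fun y hy => by
      simp [extendZero_apply _ (⟨y, hy⟩ : U)]⟩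
  rw [ContMDiffMap.coe_add, Pi.add_apply, ContMDiffMap.coe_mul, ContMDiffMap.coe_mul,
    Pi.mul_apply, Pi.mul_apply]
  simp only [smoothPartial_apply]
  rw [this.fderiv_eq, fderiv_mul (differentiableAt_extendZero f u)
    (differentiableAt_extendZero g u)]
  simp only [add_apply, smul_apply, extendZero_apply,
    smul_eq_mul]
  ring

theorem smoothRes_smoothPartial (i : Fin p) (h : V ≤ U) (f : SmoothFun p U) :
    smoothRes h (smoothPartial i f) = smoothPartial i (smoothRes h f) := by
  ext u
  have : extendZero (smoothRes h f) =ᶠ[nhds u.1] extendZero f :=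
    extendZero_eventuallyEq _ _ u ⟨V, le_rfl, u.2, fun y hy =>
      (extendZero_apply f ⟨y, h hy⟩).symm⟩
  rw [smoothPartial_apply, this.fderiv_eq]
  rfl

/-- The even coordinate vector field `∂/∂x_i` of `ℝ^{p|q}`. -/
def modelDx (q : ℕ) (i : Fin p) : SuperFun p q U →ₗ[ℝ] SuperFun p q U :=
  LinearMap.rTensor (Grassmann q) (smoothPartial i)

/-- The (left) derivative `∂/∂θ_j` of the Grassmann algebra: the odd derivation with
`∂θ_k/∂θ_j = δ_{jk}`. -/
def grassmannPartial (j : Fin q) : Grassmann q →ₗ[ℝ] Grassmann q :=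
  CliffordAlgebra.contractLeft (Q := (0 : QuadraticForm ℝ (Fin q → ℝ))) (LinearMap.proj j)

/-- The odd coordinate vector field `∂/∂θ_j` of `ℝ^{p|q}`. -/
def modelDθ (j : Fin q) : SuperFun p q U →ₗ[ℝ] SuperFun p q U :=
  LinearMap.lTensor (SmoothFun p U) (grassmannPartial j)

theorem tmul_mem_par {k : ZMod 2} (f : SmoothFun p U) {α : Grassmann q}
    (hα : α ∈ CliffordAlgebra.evenOdd (0 : QuadraticForm ℝ (Fin q → ℝ)) k) :
    f ⊗ₜ[ℝ] α ∈ (par k : Submodule ℝ (SuperFun p q U)) :=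
  ⟨f ⊗ₜ ⟨α, hα⟩, rfl⟩

theorem par_induction {k : ZMod 2} {P : SuperFun p q U → Prop}
    (tmul : ∀ f α, α ∈ CliffordAlgebra.evenOdd (0 : QuadraticForm ℝ (Fin q → ℝ)) k →
      P (f ⊗ₜ α)) (zero : P 0) (add : ∀ s t, P s → P t → P (s + t))
    {s : SuperFun p q U} (hs : s ∈ par k) : P s := by
  obtain ⟨z, rfl⟩ := hs
  induction z using TensorProduct.induction_on with
  | zero => simpa using zero
  | tmul f α => exact tmul f _ α.2
  | add x y hx hy => rw [map_add]; exact add _ _ hx hy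

theorem grassmannPartial_parity (j : Fin q) (k : ZMod 2) (α : Grassmann q)
    (hα : α ∈ CliffordAlgebra.evenOdd (0 : QuadraticForm ℝ (Fin q → ℝ)) k) :
    grassmannPartial j α ∈
      CliffordAlgebra.evenOdd (0 : QuadraticForm ℝ (Fin q → ℝ)) (k + 1) := by
  induction α, hα using CliffordAlgebra.evenOdd_induction with
  | range_ι_pow v h =>
    rcases parity_cases k with rfl | rfl
    · obtain ⟨r, rfl⟩ := Submodule.mem_one.1 (by simpa using h)
      rw [grassmannPartial, CliffordAlgebra.contractLeft_algebraMap]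
      exact Submodule.zero_mem _
    · obtain ⟨m, rfl⟩ := (by simpa [ZMod.val_one] using h : ∃ y, CliffordAlgebra.ι _ y = v)
      rw [grassmannPartial, CliffordAlgebra.contractLeft_ι]
      exact SetLike.algebraMap_mem_graded
        (CliffordAlgebra.evenOdd (0 : QuadraticForm ℝ (Fin q → ℝ))) _
  | add x y hx hy ihx ihy => rw [map_add]; exact Submodule.add_mem _ ihx ihy
  | ι_mul_ι_mul m₁ m₂ x hx ih =>
    rw [grassmannPartial, mul_assoc, CliffordAlgebra.contractLeft_ι_mul,
      CliffordAlgebra.contractLeft_ι_mul, mul_sub, ← mul_assoc]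
    refine Submodule.sub_mem _ (Submodule.smul_mem _ _ ?_) (Submodule.sub_mem _ ?_ ?_)
    · rw [add_comm k 1]
      exact SetLike.mul_mem_graded (CliffordAlgebra.ι_mem_evenOdd_one _ _) hx
    · rw [mul_smul_comm, add_comm k 1]
      exact Submodule.smul_mem _ _
        (SetLike.mul_mem_graded (CliffordAlgebra.ι_mem_evenOdd_one _ _) hx)
    · have := SetLike.mul_mem_graded (CliffordAlgebra.ι_mul_ι_mem_evenOdd_zero
        (0 : QuadraticForm ℝ (Fin q → ℝ)) m₁ m₂) ih
      rwa [zero_add] at this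

theorem grassmannPartial_mul (j : Fin q) (k : ZMod 2) (α η : Grassmann q)
    (hα : α ∈ CliffordAlgebra.evenOdd (0 : QuadraticForm ℝ (Fin q → ℝ)) k) :
    grassmannPartial j (α * η) =
      grassmannPartial j α * η + sgn 1 k • (α * grassmannPartial j η) := by
  induction α, hα using CliffordAlgebra.evenOdd_induction with
  | range_ι_pow v h =>
    rcases parity_cases k with rfl | rfl
    · obtain ⟨r, rfl⟩ := Submodule.mem_one.1 (by simpa using h)
      rw [grassmannPartial, CliffordAlgebra.contractLeft_algebraMap_mul,
        CliffordAlgebra.contractLeft_algebraMap]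
      simp [sgn]
    · obtain ⟨m, rfl⟩ := (by simpa [ZMod.val_one] using h : ∃ y, CliffordAlgebra.ι _ y = v)
      rw [grassmannPartial, CliffordAlgebra.contractLeft_ι_mul, CliffordAlgebra.contractLeft_ι]
      simp [sgn, ZMod.val_one, sub_eq_add_neg, Algebra.smul_def]
  | add x y hx hy ihx ihy =>
    rw [add_mul, map_add, map_add, ihx, ihy, add_mul, add_mul, smul_add]
    abel
  | ι_mul_ι_mul m₁ m₂ x hx ih =>
    rw [grassmannPartial] at ih ⊢
    rw [mul_assoc, mul_assoc, CliffordAlgebra.contractLeft_ι_mul,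
      CliffordAlgebra.contractLeft_ι_mul, mul_assoc, CliffordAlgebra.contractLeft_ι_mul,
      CliffordAlgebra.contractLeft_ι_mul, ih]
    simp only [mul_sub, sub_mul, mul_add, smul_mul_assoc, mul_smul_comm, mul_assoc]
    abel

theorem modelDx_mem (q : ℕ) (i : Fin p) :
    modelDx (U := U) q i ∈ homogDer (SuperHom.id (SuperFun p q U)) 0 := by
  refine ⟨fun k s hs => ?_, fun k s hs t => ?_⟩
  · rw [add_zero]
    refine par_induction (P := fun s => modelDx q i s ∈ par k) ?_ ?_ ?_ hs
    · intro f α hα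
      exact tmul_mem_par _ hα
    · rw [map_zero]; exact Submodule.zero_mem _
    · intro s t hs ht; rw [map_add]; exact Submodule.add_mem _ hs ht
  · have h1 : sgn 0 k = 1 := by simp [sgn]
    rw [h1, one_smul]
    show modelDx q i (s * t) = modelDx q i s * t + s * modelDx q i t
    clear hs
    induction s using TensorProduct.induction_on with
    | zero => simp
    | add x y hx hy => rw [add_mul, map_add, map_add, hx, hy, add_mul, add_mul]; abel
    | tmul f α =>
      induction t using TensorProduct.induction_on with
      | zero => simp
      | add x y hx hy => rw [mul_add, map_add, map_add, hx, hy, mul_add, mul_add]; abel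
      | tmul g η =>
        simp only [modelDx, Algebra.TensorProduct.tmul_mul_tmul, LinearMap.rTensor_tmul,
          smoothPartial_mul, TensorProduct.add_tmul]

theorem modelDθ_mem (j : Fin q) :
    modelDθ (U := U) j ∈ homogDer (SuperHom.id (SuperFun p q U)) 1 := by
  refine ⟨fun k s hs => ?_, fun k s hs t => ?_⟩
  · refine par_induction (P := fun s => modelDθ j s ∈ par (k + 1)) ?_ ?_ ?_ hs
    · intro f α hα
      exact tmul_mem_par _ (grassmannPartial_parity j k α hα)
    · rw [map_zero]; exact Submodule.zero_mem _
    · intro s t hs ht; rw [map_add]; exact Submodule.add_mem _ hs ht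
  · show modelDθ j (s * t) = modelDθ j s * t + sgn 1 k • (s * modelDθ j t)
    refine par_induction (P := fun s => modelDθ j (s * t) =
      modelDθ j s * t + sgn 1 k • (s * modelDθ j t)) ?_ ?_ ?_ hs
    · intro f α hα
      induction t using TensorProduct.induction_on with
      | zero => simp
      | add x y hx hy =>
        rw [mul_add, map_add, map_add, hx, hy, mul_add, mul_add, smul_add]; abel
      | tmul g η =>
        simp only [modelDθ, Algebra.TensorProduct.tmul_mul_tmul, LinearMap.lTensor_tmul,
          grassmannPartial_mul j k α η hα, TensorProduct.tmul_add, TensorProduct.tmul_smul]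
    · simp
    · intro x y hx hy
      rw [add_mul, map_add, map_add, hx, hy, add_mul, add_mul, smul_add]; abel

theorem modelRes_modelDx (q : ℕ) (i : Fin p) (h : V ≤ U) (s : SuperFun p q U) :
    modelRes q h (modelDx q i s) = modelDx q i (modelRes q h s) := by
  induction s using TensorProduct.induction_on with
  | zero => simp
  | add x y hx hy => simp only [map_add, hx, hy]
  | tmul f α => simp [modelDx, modelRes, smoothRes_smoothPartial]

theorem modelRes_modelDθ (j : Fin q) (h : V ≤ U) (s : SuperFun p q U) :
    modelRes q h (modelDθ j s) = modelDθ j (modelRes q h s) := by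
  induction s using TensorProduct.induction_on with
  | zero => simp
  | add x y hx hy => simp only [map_add, hx, hy]
  | tmul f α => simp [modelDθ, modelRes]

theorem modelEval_modelRes (h : V ≤ U) (u : V) (s : SuperFun p q U) :
    modelEval q u (modelRes q h s) = modelEval q ⟨u.1, h u.2⟩ s := by
  induction s using TensorProduct.induction_on with
  | zero => simp
  | add x y hx hy => simp only [map_add, hx, hy]
  | tmul f α => rfl

theorem modelEval_par (u : U) (k : ZMod 2) (s : SuperFun p q U) (hs : s ∈ par k) :
    modelEval q u s ∈ (par k : Submodule ℝ ℝ) := by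
  rcases parity_cases k with rfl | rfl
  · trivial
  · rw [par_real_one, Submodule.mem_bot]
    refine par_induction (P := fun s => modelEval q u s = 0) ?_ ?_ ?_ hs
    · intro f α hα
      have h0 : (ExteriorAlgebra.algebraMapInv : Grassmann q →ₐ[ℝ] ℝ) α = 0 := by
        induction α, hα using CliffordAlgebra.odd_induction with
        | ι v => simp [ExteriorAlgebra.algebraMapInv, ← ExteriorAlgebra.ι.eq_1]
        | add x y hx hy ihx ihy => rw [map_add, ihx, ihy, add_zero]
        | ι_mul_ι_mul m₁ m₂ x hx ih => rw [map_mul, ih, mul_zero]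
      simp [modelEval, h0]
    · simp
    · intro x y hx hy; rw [map_add, hx, hy, add_zero]

end Model

/-! ### Sheaves of superalgebras, stalks -/

/-- A sheaf of (commutative, real) superalgebras on a topological space. -/
structure SuperSheaf (M : Type u) [TopologicalSpace M] where
  obj : Opens M → Type v
  [ring : ∀ U, Ring (obj U)]
  [algebra : ∀ U, Algebra ℝ (obj U)]
  [parity : ∀ U, Parity (obj U)]
  [super : ∀ U, CommSuperalgebra (obj U)]
  /-- restriction of sections -/
  res : ∀ {U V : Opens M}, V ≤ U → SuperHom (obj U) (obj V)
  res_self : ∀ (U : Opens M) (s : obj U), res (le_refl U) s = s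
  res_res : ∀ {U V W : Opens M} (hVU : V ≤ U) (hWV : W ≤ V) (s : obj U),
    res hWV (res hVU s) = res (hWV.trans hVU) s
  exists_unique_glue : ∀ {ι : Type u} (U : ι → Opens M) (s : ∀ i, obj (U i)),
    (∀ i j, res (inf_le_left : U i ⊓ U j ≤ U i) (s i) = res inf_le_right (s j)) →
    ∃! t : obj (iSup U), ∀ i, res (le_iSup U i) t = s i

attribute [instance] SuperSheaf.ring SuperSheaf.algebra SuperSheaf.parity
  SuperSheaf.super

section Stalks

variable {M : Type u} [TopologicalSpace M] (F : SuperSheaf.{u, v} M) (x : M)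

/-- The sections over an open neighbourhood of `x`. -/
abbrev nhdsObj (U : (OpenNhdsOf x)ᵒᵈ) : Type v := F.obj (OrderDual.ofDual U).toOpens

/-- The restriction maps between open neighbourhoods of `x`. -/
abbrev nhdsRes (U V : (OpenNhdsOf x)ᵒᵈ) (h : U ≤ V) : nhdsObj F x U →ₐ[ℝ] nhdsObj F x V :=
  (F.res h).toAlgHom

instance : DirectedSystem (nhdsObj F x) (nhdsRes F x · · ·) where
  map_self _ := F.res_self _
  map_map _ _ _ h h' := F.res_res h h'

/-- The stalk at `x`: the direct limit of the sections over the open neighbourhoods of `x`. -/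
def Stalk : Type (max u v) :=
  DirectLimit (nhdsObj F x) (nhdsRes F x)

instance : Ring (Stalk F x) := inferInstanceAs (Ring (DirectLimit (nhdsObj F x) (nhdsRes F x)))

instance : Algebra ℝ (Stalk F x) := inferInstanceAs (Algebra ℝ (DirectLimit (nhdsObj F x) (nhdsRes F x)))

variable {x}

/-- The germ at `x` of a section over a neighbourhood of `x`. -/
def germ (U : Opens M) (hx : x ∈ U) : F.obj U →ₐ[ℝ] Stalk F x :=
  DirectLimit.Algebra.of (nhdsObj F x) (nhdsRes F x) (OrderDual.toDual ⟨U, hx⟩)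

theorem germ_res {U V : Opens M} (h : V ≤ U) (hx : x ∈ V) (s : F.obj U) :
    germ F V hx (F.res h s) = germ F U (h hx) s :=
  (DirectLimit.eq_of_le (f := nhdsRes F x)
    (⟨OrderDual.toDual ⟨U, h hx⟩, s⟩ : Σ U, nhdsObj F x U)
    (OrderDual.toDual ⟨V, hx⟩) h).symm

theorem exists_germ (g : Stalk F x) : ∃ (U : Opens M) (hx : x ∈ U) (s : F.obj U),
    germ F U hx s = g := by
  obtain ⟨U, s, h⟩ := DirectLimit.exists_eq_mk (nhdsRes F x) g
  exact ⟨(OrderDual.ofDual U).toOpens, (OrderDual.ofDual U).mem, s, h.symm⟩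

theorem germ_eq_iff {U V : Opens M} (hU : x ∈ U) (hV : x ∈ V) (s : F.obj U) (t : F.obj V) :
    germ F U hU s = germ F V hV t ↔
      ∃ (W : Opens M) (_ : x ∈ W) (h : W ≤ U) (h' : W ≤ V), F.res h s = F.res h' t := by
  constructor
  · intro h
    obtain ⟨W, hU, hV, h⟩ := Quotient.exact h
    exact ⟨(OrderDual.ofDual W).toOpens, (OrderDual.ofDual W).mem, hU, hV, h⟩
  · rintro ⟨W, hx, h, h', e⟩
    rw [← germ_res F h hx, ← germ_res F h' hx, e]

variable (x) in
/-- A germ is even (odd) if it is the germ of an even (odd) section. -/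
instance : Parity (Stalk F x) where
  par k := ⨆ U : OpenNhdsOf x, (par k : Submodule ℝ (F.obj U.toOpens)).map
    (germ F U.toOpens U.mem).toLinearMap

theorem germ_par {U : Opens M} (hx : x ∈ U) (k : ZMod 2) (s : F.obj U) (hs : s ∈ par k) :
    germ F U hx s ∈ (par k : Submodule ℝ (Stalk F x)) :=
  Submodule.mem_iSup_of_mem (⟨U, hx⟩ : OpenNhdsOf x) ⟨s, hs, rfl⟩

/-- The germ map as a morphism of superalgebras. -/
def germHom (U : Opens M) (hx : x ∈ U) : SuperHom (F.obj U) (Stalk F x) :=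
  ⟨germ F U hx, germ_par F hx⟩

theorem stalk_par_induction {k : ZMod 2} (P : Submodule ℝ (Stalk F x))
    (h : ∀ (U : Opens M) (hx : x ∈ U) (s : F.obj U), s ∈ par k → germ F U hx s ∈ P)
    {g : Stalk F x} (hg : g ∈ par k) : g ∈ P := by
  refine (iSup_le fun U => ?_ : (par k : Submodule ℝ (Stalk F x)) ≤ P) hg
  rintro _ ⟨s, hs, rfl⟩
  exact h _ _ s hs

/-- A compatible family of algebra morphisms on sections near `x` defines one on the stalk. -/
def stalkLift {P : Type*} [Ring P] [Algebra ℝ P]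
    (g : ∀ U : Opens M, x ∈ U → (F.obj U →ₐ[ℝ] P))
    (hg : ∀ (U V : Opens M) (h : V ≤ U) (hx : x ∈ V) (s : F.obj U),
      g V hx (F.res h s) = g U (h hx) s) : Stalk F x →ₐ[ℝ] P :=
  DirectLimit.Algebra.lift (nhdsObj F x) (nhdsRes F x) P
    (fun U => g (OrderDual.ofDual U).toOpens (OrderDual.ofDual U).mem)
    (fun _ _ h s => hg _ _ h _ s)

theorem stalkLift_germ {P : Type*} [Ring P] [Algebra ℝ P]
    (g : ∀ U : Opens M, x ∈ U → (F.obj U →ₐ[ℝ] P)) (hg) (U : Opens M) (hx : x ∈ U)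
    (s : F.obj U) : stalkLift F g hg (germ F U hx s) = g U hx s := rfl

end Stalks

/-! ### Charts and smooth supermanifolds -/

/-- The source of an open partial homeomorphism. -/
def homeoSource {M E : Type*} [TopologicalSpace M] [TopologicalSpace E]
    (e : OpenPartialHomeomorph M E) : Opens M :=
  ⟨e.source, e.open_source⟩

/-- The image of (the part in the source of) an open set. -/
def homeoImage {M E : Type*} [TopologicalSpace M] [TopologicalSpace E]
    (e : OpenPartialHomeomorph M E) (W : Opens M) : Opens E :=
  ⟨e '' (e.source ∩ W), e.isOpen_image_source_inter W.isOpen⟩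

theorem homeoImage_mono {M E : Type*} [TopologicalSpace M] [TopologicalSpace E]
    (e : OpenPartialHomeomorph M E) {W W' : Opens M} (h : W' ≤ W) :
    homeoImage e W' ≤ homeoImage e W :=
  Set.image_mono (Set.inter_subset_inter_right _ h)

/-- A chart of dimension `p|q` of a superspace `(M, F)`: a homeomorphism `φ` from an open set
`V ⊆ M` onto an open set of `ℝ^p` together with an isomorphism, over `φ`, of the restriction of
`F` to `V` with the structure sheaf of the superdomain `φ(V) ⊆ ℝ^{p|q}`. -/
structure SuperChart {M : Type u} [TopologicalSpace M] (F : SuperSheaf.{u, v} M) (p q : ℕ) where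
  homeo : OpenPartialHomeomorph M (EuclideanSpace ℝ (Fin p))
  iso : ∀ W : Opens M, W ≤ homeoSource homeo →
    (F.obj W ≃ₐ[ℝ] SuperFun p q (homeoImage homeo W))
  iso_par : ∀ (W : Opens M) (hW : W ≤ homeoSource homeo) (k : ZMod 2) (s : F.obj W),
    iso W hW s ∈ par k ↔ s ∈ par k
  iso_res : ∀ (W W' : Opens M) (hW : W ≤ homeoSource homeo) (h : W' ≤ W) (s : F.obj W),
    iso W' (h.trans hW) (F.res h s) = modelRes q (homeoImage_mono homeo h) (iso W hW s)

/-- A smooth supermanifold of dimension `p|q` with underlying topological space `M`. -/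
structure Supermanifold (M : Type u) [TopologicalSpace M] (p q : ℕ) extends
    SuperSheaf.{u, v} M where
  exists_chart : ∀ x : M, ∃ c : SuperChart toSuperSheaf p q, x ∈ homeoSource c.homeo

namespace SuperChart

variable {M : Type u} [TopologicalSpace M] {F : SuperSheaf.{u, v} M} {p q : ℕ}
  (c : SuperChart F p q)

/-- The domain of a chart. -/
abbrev source : Opens M := homeoSource c.homeo

/-- The image of an open set. -/
abbrev image (W : Opens M) : Opens (EuclideanSpace ℝ (Fin p)) := homeoImage c.homeo W

/-- The evaluation of sections at `x`, computed in a chart: the value at `x` of the reduction. -/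
def evalOn {x : M} (hx : x ∈ c.source) (U : Opens M) (hU : x ∈ U) : F.obj U →ₐ[ℝ] ℝ :=
  (modelEval q (⟨c.homeo x, ⟨x, ⟨hx, hU, hx⟩, rfl⟩⟩ : c.image (U ⊓ c.source))).comp
    (((c.iso (U ⊓ c.source) inf_le_right).toAlgHom).comp
      (F.res (inf_le_left : U ⊓ c.source ≤ U)).toAlgHom)

theorem evalOn_res {x : M} (hx : x ∈ c.source) (U V : Opens M) (h : V ≤ U) (hV : x ∈ V)
    (s : F.obj U) : c.evalOn hx V hV (F.res h s) = c.evalOn hx U (h hV) s := by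
  have h1 := c.iso_res (U ⊓ c.source) (V ⊓ c.source) inf_le_right
    (inf_le_inf_right _ h) (F.res inf_le_left s)
  rw [F.res_res] at h1
  show modelEval q _ (c.iso _ _ (F.res _ (F.res h s))) = modelEval q _ (c.iso _ _ (F.res _ s))
  rw [F.res_res, h1]
  exact modelEval_modelRes _ _ _

/-- The evaluation of germs at `x`, computed in a chart. -/
def eval {x : M} (hx : x ∈ c.source) : SuperHom (Stalk F x) ℝ where
  toAlgHom := stalkLift F (c.evalOn hx) (c.evalOn_res hx)
  map_par k g hg := by
    refine stalk_par_induction F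
      ((par k : Submodule ℝ ℝ).comap (stalkLift F (c.evalOn hx) (c.evalOn_res hx)).toLinearMap)
      (fun U hU s hs => ?_) hg
    exact modelEval_par _ k _ ((c.iso_par _ _ k _).2 ((F.res _).map_par k s hs))

end SuperChart

/-! ### Vector fields -/

section VectorFields

variable {M : Type u} [TopologicalSpace M] (F : SuperSheaf.{u, v} M)

/-- The homogeneous derivations of parity `k` of the sheaf `F` restricted to `U`: compatible
families of derivations of parity `k` of the superalgebras `F(W)`, `W ⊆ U`. -/
def homogVectorField (U : Opens M) (k : ZMod 2) :
    Submodule ℝ (∀ W : {W : Opens M // W ≤ U}, F.obj W.1 →ₗ[ℝ] F.obj W.1) where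
  carrier := {D | (∀ W, D W ∈ homogDer (SuperHom.id (F.obj W.1)) k) ∧
    ∀ (W W' : {W : Opens M // W ≤ U}) (h : W'.1 ≤ W.1) (s : F.obj W.1),
      F.res h (D W s) = D W' (F.res h s)}
  zero_mem' := ⟨fun _ => Submodule.zero_mem _, fun _ _ _ _ => map_zero _⟩
  add_mem' := fun {D E} hD hE => ⟨fun W => Submodule.add_mem _ (hD.1 W) (hE.1 W),
    fun W W' h s => by
      simp only [Pi.add_apply, LinearMap.add_apply, map_add, hD.2 W W' h s, hE.2 W W' h s]⟩
  smul_mem' := fun c {D} hD => ⟨fun W => Submodule.smul_mem _ c (hD.1 W),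
    fun W W' h s => by
      simp only [Pi.smul_apply, LinearMap.smul_apply, map_smul, hD.2 W W' h s]⟩

/-- The vector fields on `U`, i.e. the sections over `U` of the sheaf of derivations of `F`:
sums of an even and an odd derivation. -/
def VectorField (U : Opens M) :
    Submodule ℝ (∀ W : {W : Opens M // W ≤ U}, F.obj W.1 →ₗ[ℝ] F.obj W.1) :=
  homogVectorField F U 0 ⊔ homogVectorField F U 1

variable {F}

theorem homog_le_vectorField (U : Opens M) (k : ZMod 2) :
    homogVectorField F U k ≤ VectorField F U := by
  rcases parity_cases k with rfl | rfl
  · exact le_sup_left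
  · exact le_sup_right

theorem VectorField.induction {U : Opens M}
    (P : Submodule ℝ (∀ W : {W : Opens M // W ≤ U}, F.obj W.1 →ₗ[ℝ] F.obj W.1))
    (h : ∀ k, homogVectorField F U k ≤ P) : VectorField F U ≤ P :=
  sup_le (h 0) (h 1)

theorem VectorField.res_apply {U : Opens M} (D : VectorField F U) {W W' : Opens M}
    (hW : W ≤ U) (h : W' ≤ W) (s : F.obj W) :
    F.res h (D.1 ⟨W, hW⟩ s) = D.1 ⟨W', h.trans hW⟩ (F.res h s) := by
  obtain ⟨D, hD⟩ := D
  obtain ⟨D₀, h₀, D₁, h₁, rfl⟩ := Submodule.mem_sup.1 hD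
  simp only [Pi.add_apply, LinearMap.add_apply, map_add]
  rw [h₀.2 ⟨W, hW⟩ ⟨W', h.trans hW⟩ h, h₁.2 ⟨W, hW⟩ ⟨W', h.trans hW⟩ h]

/-- Restriction of families to a smaller open set. -/
def restrictFamily {U V : Opens M} (h : V ≤ U) :
    (∀ W : {W : Opens M // W ≤ U}, F.obj W.1 →ₗ[ℝ] F.obj W.1) →ₗ[ℝ]
      (∀ W : {W : Opens M // W ≤ V}, F.obj W.1 →ₗ[ℝ] F.obj W.1) where
  toFun D W := D ⟨W.1, W.2.trans h⟩
  map_add' _ _ := rfl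
  map_smul' _ _ := rfl

theorem restrictFamily_mem {U V : Opens M} (h : V ≤ U) :
    VectorField F U ≤ (VectorField F V).comap (restrictFamily h) :=
  VectorField.induction _ fun k _ hD => homog_le_vectorField V k
    ⟨fun W => hD.1 ⟨W.1, W.2.trans h⟩, fun W W' h' s =>
      hD.2 ⟨W.1, W.2.trans h⟩ ⟨W'.1, W'.2.trans h⟩ h' s⟩

/-- Restriction of vector fields. -/
def VectorField.restrict {U V : Opens M} (h : V ≤ U) : VectorField F U →ₗ[ℝ] VectorField F V :=
  (restrictFamily h).restrict (restrictFamily_mem h)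

/-- Left multiplication of a family by a section: `(r D)(s) = r D(s)`. -/
def smulFamily {U : Opens M} (r : F.obj U) :
    (∀ W : {W : Opens M // W ≤ U}, F.obj W.1 →ₗ[ℝ] F.obj W.1) →ₗ[ℝ]
      (∀ W : {W : Opens M // W ≤ U}, F.obj W.1 →ₗ[ℝ] F.obj W.1) where
  toFun D W := F.res W.2 r • D W
  map_add' _ _ := by ext; simp
  map_smul' c D := by
    ext W s
    simp only [Pi.smul_apply, LinearMap.smul_apply, smul_eq_mul, RingHom.id_apply,
      mul_smul_comm]

theorem smulFamily_mem {U : Opens M} (r : F.obj U) :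
    VectorField F U ≤ (VectorField F U).comap (smulFamily r) := by
  have key : ∀ i, ∀ r ∈ (par i : Submodule ℝ (F.obj U)),
      VectorField F U ≤ (VectorField F U).comap (smulFamily r) := fun i r hr =>
    VectorField.induction _ fun k D hD => homog_le_vectorField U (k + i)
      ⟨fun W => smul_homogDer _ ((F.res W.2).map_par i r hr) (hD.1 W), fun W W' h s => by
        show F.res h (F.res W.2 r * D W s) = F.res W'.2 r * D W' (F.res h s)
        rw [map_mul, hD.2 W W' h s, F.res_res]⟩
  intro D hD
  classical
  have e : smulFamily r D = ∑ i ∈ DFinsupp.support (DirectSum.decompose par r),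
      smulFamily (DirectSum.decompose par r i : F.obj U) D := by
    funext W
    rw [Finset.sum_apply]
    show F.res W.2 r • D W = ∑ i ∈ _, F.res W.2 _ • D W
    rw [← Finset.sum_smul, ← map_sum, DirectSum.sum_support_decompose]
  show smulFamily r D ∈ VectorField F U
  rw [e]
  exact Submodule.sum_mem _ fun i _ => key i _ (SetLike.coe_mem _) hD

/-- The left `F(U)`-module structure of the vector fields on `U`. -/
instance (U : Opens M) : Module (F.obj U) (VectorField F U) where
  smul r D := ⟨smulFamily r D.1, smulFamily_mem r D.2⟩
  one_smul D := by
    ext W s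
    show F.res W.2 1 * D.1 W s = D.1 W s
    rw [map_one, one_mul]
  mul_smul r r' D := by
    ext W s
    show F.res W.2 (r * r') * D.1 W s = F.res W.2 r * (F.res W.2 r' * D.1 W s)
    rw [map_mul, mul_assoc]
  smul_zero r := by
    ext W s
    exact mul_zero _
  smul_add r D E := by
    ext W s
    exact mul_add _ _ _
  add_smul r r' D := by
    ext W s
    show F.res W.2 (r + r') * D.1 W s = F.res W.2 r * D.1 W s + F.res W.2 r' * D.1 W s
    rw [map_add, add_mul]
  zero_smul D := by
    ext W s
    show F.res W.2 0 * D.1 W s = 0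
    rw [map_zero, zero_mul]

theorem VectorField.smul_apply {U : Opens M} (r : F.obj U) (D : VectorField F U)
    (W : {W : Opens M // W ≤ U}) (s : F.obj W.1) : (r • D).1 W s = F.res W.2 r * D.1 W s := rfl

theorem VectorField.restrict_smul {U V : Opens M} (h : V ≤ U) (r : F.obj U)
    (D : VectorField F U) :
    VectorField.restrict h (r • D) = F.res h r • VectorField.restrict h D := by
  apply Subtype.ext
  funext W
  show F.res (W.2.trans h) r • D.1 ⟨W.1, W.2.trans h⟩ =
    F.res W.2 (F.res h r) • D.1 ⟨W.1, W.2.trans h⟩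
  rw [F.res_res]

end VectorFields

section VectorFieldGerms

variable {M : Type u} [TopologicalSpace M] (F : SuperSheaf.{u, v} M) (x : M)

/-- The vector fields on an open neighbourhood of `x`. -/
abbrev nhdsVF (U : (OpenNhdsOf x)ᵒᵈ) : Type (max u v) :=
  VectorField F (OrderDual.ofDual U).toOpens

/-- The restriction maps of vector fields between open neighbourhoods of `x`. -/
abbrev nhdsVFRes (U V : (OpenNhdsOf x)ᵒᵈ) (h : U ≤ V) : nhdsVF F x U →ₗ[ℝ] nhdsVF F x V :=
  VectorField.restrict h

instance : DirectedSystem (nhdsVF F x) (nhdsVFRes F x · · ·) where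
  map_self _ _ := rfl
  map_map _ _ _ _ _ _ := rfl

/-- The germs of vector fields at `x`: the stalk at `x` of the sheaf of derivations of `F`. -/
def VFGerm : Type (max u v) := DirectLimit (nhdsVF F x) (nhdsVFRes F x)

instance : AddCommGroup (VFGerm F x) :=
  inferInstanceAs (AddCommGroup (DirectLimit (nhdsVF F x) (nhdsVFRes F x)))

instance : Module ℝ (VFGerm F x) :=
  inferInstanceAs (Module ℝ (DirectLimit (nhdsVF F x) (nhdsVFRes F x)))

variable {x}

/-- The germ at `x` of a vector field on a neighbourhood of `x`. -/
def vfGerm (U : Opens M) (hx : x ∈ U) : VectorField F U →ₗ[ℝ] VFGerm F x :=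
  DirectLimit.Module.of ℝ _ (nhdsVF F x) (nhdsVFRes F x) (OrderDual.toDual ⟨U, hx⟩)

theorem exists_vfGerm (ξ : VFGerm F x) : ∃ (U : Opens M) (hx : x ∈ U) (D : VectorField F U),
    vfGerm F U hx D = ξ := by
  obtain ⟨U, D, h⟩ := DirectLimit.exists_eq_mk (nhdsVFRes F x) ξ
  exact ⟨(OrderDual.ofDual U).toOpens, (OrderDual.ofDual U).mem, D, h.symm⟩

theorem vfGerm_restrict {U V : Opens M} (h : V ≤ U) (hx : x ∈ V) (D : VectorField F U) :
    vfGerm F V hx (VectorField.restrict h D) = vfGerm F U (h hx) D :=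
  (DirectLimit.eq_of_le (f := nhdsVFRes F x)
    (⟨OrderDual.toDual ⟨U, h hx⟩, D⟩ : Σ U, nhdsVF F x U)
    (OrderDual.toDual ⟨V, hx⟩) h).symm

/-- The product of a germ of a section and a germ of a vector field. -/
instance : SMul (Stalk F x) (VFGerm F x) where
  smul := DirectLimit.map₂ (nhdsRes F x) (nhdsVFRes F x) (nhdsVFRes F x)
    (fun U (r : F.obj (OrderDual.ofDual U).toOpens)
      (D : VectorField F (OrderDual.ofDual U).toOpens) => (r • D : VectorField F _))
    (fun _ _ h r D => VectorField.restrict_smul h r D)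

theorem germ_smul_vfGerm (U : Opens M) (hx : x ∈ U) (r : F.obj U) (D : VectorField F U) :
    germ F U hx r • vfGerm F U hx D = vfGerm F U hx (r • D) :=
  DirectLimit.map₂_def (nhdsRes F x) (nhdsVFRes F x) (nhdsVFRes F x)
    (fun U (r : F.obj (OrderDual.ofDual U).toOpens)
      (D : VectorField F (OrderDual.ofDual U).toOpens) => (r • D : VectorField F _))
    (fun _ _ h r D => VectorField.restrict_smul h r D)
    (OrderDual.toDual ⟨U, hx⟩) r D

/-- The action of germs of vector fields on germs of sections. -/
def actFun : VFGerm F x → Stalk F x → Stalk F x :=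
  DirectLimit.map₂ (nhdsVFRes F x) (nhdsRes F x) (nhdsRes F x)
    (fun U (D : VectorField F (OrderDual.ofDual U).toOpens)
      (s : F.obj (OrderDual.ofDual U).toOpens) => D.1 ⟨_, le_rfl⟩ s)
    (fun _ _ h D s => VectorField.res_apply D le_rfl h s)

theorem actFun_germ (U : Opens M) (hx : x ∈ U) (D : VectorField F U) (s : F.obj U) :
    actFun F (vfGerm F U hx D) (germ F U hx s) = germ F U hx (D.1 ⟨U, le_rfl⟩ s) :=
  DirectLimit.map₂_def (nhdsVFRes F x) (nhdsRes F x) (nhdsRes F x)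
    (fun U (D : VectorField F (OrderDual.ofDual U).toOpens)
      (s : F.obj (OrderDual.ofDual U).toOpens) => D.1 ⟨_, le_rfl⟩ s)
    (fun _ _ h D s => VectorField.res_apply D le_rfl h s)
    (OrderDual.toDual ⟨U, hx⟩) D s

theorem exists_germ₂ (g h : Stalk F x) : ∃ (U : Opens M) (hx : x ∈ U) (s t : F.obj U),
    germ F U hx s = g ∧ germ F U hx t = h := by
  obtain ⟨U, hU, s, rfl⟩ := exists_germ F g
  obtain ⟨V, hV, t, rfl⟩ := exists_germ F h
  exact ⟨U ⊓ V, ⟨hU, hV⟩, F.res inf_le_left s, F.res inf_le_right t,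
    germ_res F _ _ s, germ_res F _ _ t⟩

theorem exists_vfGerm_germ₂ (ξ : VFGerm F x) (g h : Stalk F x) :
    ∃ (U : Opens M) (hx : x ∈ U) (D : VectorField F U) (s t : F.obj U),
      vfGerm F U hx D = ξ ∧ germ F U hx s = g ∧ germ F U hx t = h := by
  obtain ⟨U, hU, D, rfl⟩ := exists_vfGerm F ξ
  obtain ⟨V, hV, s, t, rfl, rfl⟩ := exists_germ₂ F g h
  exact ⟨U ⊓ V, ⟨hU, hV⟩, VectorField.restrict inf_le_left D, F.res inf_le_right s,
    F.res inf_le_right t, vfGerm_restrict F _ _ D, germ_res F _ _ s, germ_res F _ _ t⟩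

theorem exists_vfGerm₂_germ₂ (ξ η : VFGerm F x) (g h : Stalk F x) :
    ∃ (U : Opens M) (hx : x ∈ U) (D E : VectorField F U) (s t : F.obj U),
      vfGerm F U hx D = ξ ∧ vfGerm F U hx E = η ∧ germ F U hx s = g ∧ germ F U hx t = h := by
  obtain ⟨U, hU, D, rfl⟩ := exists_vfGerm F ξ
  obtain ⟨V, hV, E, s, t, rfl, rfl, rfl⟩ := exists_vfGerm_germ₂ F η g h
  exact ⟨U ⊓ V, ⟨hU, hV⟩, VectorField.restrict inf_le_left D, VectorField.restrict inf_le_right E,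
    F.res inf_le_right s, F.res inf_le_right t, vfGerm_restrict F _ _ D, vfGerm_restrict F _ _ E,
    germ_res F _ _ s, germ_res F _ _ t⟩

/-- The left module structure of the germs of vector fields over the stalk. -/
instance : Module (Stalk F x) (VFGerm F x) where
  one_smul ξ := by
    obtain ⟨U, hU, D, rfl⟩ := exists_vfGerm F ξ
    rw [← map_one (germ F U hU), germ_smul_vfGerm, one_smul]
  mul_smul r r' ξ := by
    obtain ⟨U, hU, D, s, t, rfl, rfl, rfl⟩ := exists_vfGerm_germ₂ F ξ r r'
    rw [← map_mul, germ_smul_vfGerm, germ_smul_vfGerm, germ_smul_vfGerm, mul_smul]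
  smul_zero r := by
    obtain ⟨U, hU, s, rfl⟩ := exists_germ F r
    rw [← map_zero (vfGerm F U hU), germ_smul_vfGerm, smul_zero]
  smul_add r ξ η := by
    obtain ⟨U, hU, D, E, s, t, rfl, rfl, rfl, -⟩ := exists_vfGerm₂_germ₂ F ξ η r r
    rw [← map_add, germ_smul_vfGerm, germ_smul_vfGerm, germ_smul_vfGerm, smul_add, map_add]
  add_smul r r' ξ := by
    obtain ⟨U, hU, D, s, t, rfl, rfl, rfl⟩ := exists_vfGerm_germ₂ F ξ r r'
    rw [← map_add, germ_smul_vfGerm, germ_smul_vfGerm, germ_smul_vfGerm, add_smul, map_add]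
  zero_smul ξ := by
    obtain ⟨U, hU, D, rfl⟩ := exists_vfGerm F ξ
    rw [← map_zero (germ F U hU), germ_smul_vfGerm, zero_smul, map_zero]

/-- The germ of a vector field as a linear endomorphism of the stalk. -/
def act (ξ : VFGerm F x) : Stalk F x →ₗ[ℝ] Stalk F x where
  toFun := actFun F ξ
  map_add' g h := by
    obtain ⟨U, hU, D, s, t, rfl, rfl, rfl⟩ := exists_vfGerm_germ₂ F ξ g h
    rw [← map_add, actFun_germ, actFun_germ, actFun_germ, map_add, map_add]
  map_smul' c g := by
    obtain ⟨U, hU, D, s, t, rfl, rfl, -⟩ := exists_vfGerm_germ₂ F ξ g g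
    rw [← map_smul, actFun_germ, actFun_germ, map_smul, map_smul, RingHom.id_apply]

theorem act_germ (U : Opens M) (hx : x ∈ U) (D : VectorField F U) (s : F.obj U) :
    act F (vfGerm F U hx D) (germ F U hx s) = germ F U hx (D.1 ⟨U, le_rfl⟩ s) :=
  actFun_germ F U hx D s

theorem act_add (ξ η : VFGerm F x) : act F (ξ + η) = act F ξ + act F η := by
  ext g
  obtain ⟨U, hU, D, E, s, t, rfl, rfl, rfl, -⟩ := exists_vfGerm₂_germ₂ F ξ η g g
  rw [LinearMap.add_apply, ← map_add, act_germ, act_germ, act_germ, ← map_add]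
  rfl

/-- The action of the germ of a homogeneous vector field is a homogeneous derivation. -/
theorem act_homog {U : Opens M} (hU : x ∈ U) {k : ZMod 2} (D : VectorField F U)
    (hD : D.1 ∈ homogVectorField F U k) :
    act F (vfGerm F U hU D) ∈ homogDer (SuperHom.id (Stalk F x)) k := by
  refine ⟨fun j g hg => ?_, fun j g hg h => ?_⟩
  · refine stalk_par_induction F ((par (j + k)).comap (act F (vfGerm F U hU D))) ?_ hg
    intro V hV s hs
    have hN : x ∈ U ⊓ V := ⟨hU, hV⟩
    rw [Submodule.mem_comap, ← vfGerm_restrict F (inf_le_left : U ⊓ V ≤ U) hN,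
      ← germ_res F (inf_le_right : U ⊓ V ≤ V) hN, act_germ]
    exact germ_par F _ _ _ ((hD.1 ⟨U ⊓ V, inf_le_left⟩).1 j _ ((F.res _).map_par j s hs))
  · show act F (vfGerm F U hU D) (g * h) = act F (vfGerm F U hU D) g * h +
      sgn k j • (g * act F (vfGerm F U hU D) h)
    set ξ := vfGerm F U hU D with hξ
    let L : Stalk F x →ₗ[ℝ] Stalk F x := act F ξ ∘ₗ LinearMap.mulRight ℝ h -
      LinearMap.mulRight ℝ h ∘ₗ act F ξ - sgn k j • LinearMap.mulRight ℝ (act F ξ h)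
    suffices hL : g ∈ LinearMap.ker L by
      have : act F ξ (g * h) - act F ξ g * h - sgn k j • (g * act F ξ h) = 0 := hL
      rw [sub_sub, sub_eq_zero] at this
      exact this
    refine stalk_par_induction F (LinearMap.ker L) ?_ hg
    intro V hV s hs
    show act F ξ (germ F V hV s * h) - act F ξ (germ F V hV s) * h -
      sgn k j • (germ F V hV s * act F ξ h) = 0
    obtain ⟨W, hW, t, rfl⟩ := exists_germ F h
    have hN : x ∈ U ⊓ (V ⊓ W) := ⟨hU, hV, hW⟩
    have hNU : U ⊓ (V ⊓ W) ≤ U := inf_le_left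
    have hNV : U ⊓ (V ⊓ W) ≤ V := inf_le_right.trans inf_le_left
    have hNW : U ⊓ (V ⊓ W) ≤ W := inf_le_right.trans inf_le_right
    rw [hξ, ← vfGerm_restrict F hNU hN, ← germ_res F hNV hN, ← germ_res F hNW hN, ← map_mul,
      act_germ, act_germ, act_germ, ← map_mul, ← map_mul, ← map_smul, ← map_sub, ← map_sub]
    rw [sub_sub, sub_eq_zero.2, map_zero]
    exact (hD.1 ⟨U ⊓ (V ⊓ W), hNU⟩).2 j _ ((F.res hNV).map_par j s hs) _

theorem comp_act_mem {A : Type*} [Ring A] [Algebra ℝ A] [Parity A] [CommSuperalgebra A]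
    (φ : SuperHom (Stalk F x) A) (ξ : VFGerm F x) :
    φ.toAlgHom.toLinearMap ∘ₗ act F ξ ∈ superDer φ := by
  have key : ∀ (U : Opens M) (hU : x ∈ U) (k : ZMod 2) (D : VectorField F U),
      D.1 ∈ homogVectorField F U k →
      φ.toAlgHom.toLinearMap ∘ₗ act F (vfGerm F U hU D) ∈ homogDer φ k := by
    intro U hU k D hD
    obtain ⟨h1, h2⟩ := act_homog F hU D hD
    refine ⟨fun j g hg => φ.map_par _ _ (h1 j g hg), fun j g hg h => ?_⟩
    show φ (act F _ (g * h)) = φ (act F _ g) * φ h + sgn k j • (φ g * φ (act F _ h))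
    rw [h2 j g hg h, map_add, map_smul, map_mul, map_mul]
    rfl
  obtain ⟨U, hU, ⟨D, hD⟩, rfl⟩ := exists_vfGerm F ξ
  obtain ⟨D₀, h₀, D₁, h₁, rfl⟩ := Submodule.mem_sup.1 hD
  have e : vfGerm F U hU ⟨D₀ + D₁, hD⟩ =
      vfGerm F U hU ⟨D₀, homog_le_vectorField U 0 h₀⟩ +
        vfGerm F U hU ⟨D₁, homog_le_vectorField U 1 h₁⟩ := by
    rw [← map_add]; rfl
  rw [e, act_add, LinearMap.comp_add]
  exact Submodule.add_mem_sup (key U hU 0 _ h₀) (key U hU 1 _ h₁)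

end VectorFieldGerms

/-! ### Coordinate vector fields of a chart -/

namespace SuperChart

variable {M : Type u} [TopologicalSpace M] {F : SuperSheaf.{u, v} M} {p q : ℕ}
  (c : SuperChart F p q)

/-- Transport of a linear operator of the local model to the sections over `W`. -/
def pull (W : Opens M) (hW : W ≤ c.source)
    (D : SuperFun p q (c.image W) →ₗ[ℝ] SuperFun p q (c.image W)) : F.obj W →ₗ[ℝ] F.obj W :=
  (c.iso W hW).symm.toLinearMap ∘ₗ D ∘ₗ (c.iso W hW).toLinearMap

theorem pull_mem (W : Opens M) (hW : W ≤ c.source) {k : ZMod 2}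
    {D : SuperFun p q (c.image W) →ₗ[ℝ] SuperFun p q (c.image W)}
    (hD : D ∈ homogDer (SuperHom.id _) k) :
    c.pull W hW D ∈ homogDer (SuperHom.id (F.obj W)) k := by
  refine ⟨fun j s hs => ?_, fun j s hs t => ?_⟩
  · refine (c.iso_par W hW _ _).1 ?_
    show c.iso W hW ((c.iso W hW).symm (D (c.iso W hW s))) ∈ par (j + k)
    rw [AlgEquiv.apply_symm_apply]
    exact hD.1 j _ ((c.iso_par W hW j s).2 hs)
  · show (c.iso W hW).symm (D (c.iso W hW (s * t))) =
      (c.iso W hW).symm (D (c.iso W hW s)) * t +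
        sgn k j • (s * (c.iso W hW).symm (D (c.iso W hW t)))
    apply (c.iso W hW).injective
    rw [map_add, map_smul, map_mul (c.iso W hW), map_mul (c.iso W hW), map_mul (c.iso W hW),
      AlgEquiv.apply_symm_apply, AlgEquiv.apply_symm_apply, AlgEquiv.apply_symm_apply]
    exact hD.2 j _ ((c.iso_par W hW j s).2 hs) _

theorem res_pull {W W' : Opens M} (hW : W ≤ c.source) (h : W' ≤ W)
    {D : SuperFun p q (c.image W) →ₗ[ℝ] SuperFun p q (c.image W)}
    {D' : SuperFun p q (c.image W') →ₗ[ℝ] SuperFun p q (c.image W')}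
    (hD : ∀ (h' : c.image W' ≤ c.image W) (s), modelRes q h' (D s) = D' (modelRes q h' s))
    (s : F.obj W) : F.res h (c.pull W hW D s) = c.pull W' (h.trans hW) D' (F.res h s) := by
  apply (c.iso W' (h.trans hW)).injective
  show c.iso W' _ (F.res h ((c.iso W hW).symm (D (c.iso W hW s)))) =
    c.iso W' _ ((c.iso W' _).symm (D' (c.iso W' _ (F.res h s))))
  rw [AlgEquiv.apply_symm_apply, c.iso_res W W' hW h, c.iso_res W W' hW h,
    AlgEquiv.apply_symm_apply]
  exact hD _ _

/-- The even coordinate vector field `∂/∂x_i` on the domain of the chart. -/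
def dx (i : Fin p) : VectorField F c.source :=
  ⟨fun W => c.pull W.1 W.2 (modelDx q i), homog_le_vectorField c.source 0
    ⟨fun W => c.pull_mem W.1 W.2 (modelDx_mem q i), fun W _ h s =>
      c.res_pull W.2 h (fun h' s => modelRes_modelDx q i h' s) s⟩⟩

/-- The odd coordinate vector field `∂/∂θ_j` on the domain of the chart. -/
def dθ (j : Fin q) : VectorField F c.source :=
  ⟨fun W => c.pull W.1 W.2 (modelDθ j), homog_le_vectorField c.source 1
    ⟨fun W => c.pull_mem W.1 W.2 (modelDθ_mem j), fun W _ h s =>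
      c.res_pull W.2 h (fun h' s => modelRes_modelDθ j h' s) s⟩⟩

end SuperChart

/-! ### Tangent superspace, `A`-points, derivations along an `A`-point -/

namespace Supermanifold

variable {M : Type u} [TopologicalSpace M] {p q : ℕ} (X : Supermanifold.{u, v} M p q) (x : M)

/-- A chart around `x`. -/
def chartAt : SuperChart X.toSuperSheaf p q := (X.exists_chart x).choose

theorem mem_chartAt : x ∈ (X.chartAt x).source := (X.exists_chart x).choose_spec

/-- The evaluation `ev_x` of germs at `x`: the value at `x` of the reduction. It does not depend
on the chart that is used to compute it. -/
def ev : SuperHom (Stalk X.toSuperSheaf x) ℝ := (X.chartAt x).eval (X.mem_chartAt x)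

/-- The tangent superspace `T_x(M)`: the derivations of the stalk at `x` with values in `ℝ`. -/
abbrev TangentSuperspace : Type (max u v) := superDer (X.ev x)

/-- The `A`-points near `x`: the superalgebra morphisms from the stalk at `x` to `A`. -/
abbrev APoint (A : Type w) [Ring A] [Algebra ℝ A] [Parity A] : Type (max u v w) :=
  SuperHom (Stalk X.toSuperSheaf x) A

variable {X x} {A : Type w} [Ring A] [Algebra ℝ A] [Parity A]

/-- The value of a germ of a vector field at `x`. -/
def tangent (ξ : VFGerm X.toSuperSheaf x) : X.TangentSuperspace x :=
  ⟨(X.ev x).toAlgHom.toLinearMap ∘ₗ act X.toSuperSheaf ξ, comp_act_mem _ _ ξ⟩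

/-- The morphism `𝒪(U) → A` defined by an `A`-point near `x ∈ U`. -/
def APoint.on (xA : X.APoint x A) (U : Opens M) (hx : x ∈ U) : SuperHom (X.obj U) A :=
  SuperHom.comp xA (germHom X.toSuperSheaf U hx)

/-- The map `x_A ∘ ξ : 𝒪(U) → A` for a germ `ξ` of a vector field at `x ∈ U`. -/
def APoint.compVF (xA : X.APoint x A) (U : Opens M) (hx : x ∈ U) (ξ : VFGerm X.toSuperSheaf x) :
    X.obj U →ₗ[ℝ] A :=
  xA.toAlgHom.toLinearMap ∘ₗ act X.toSuperSheaf ξ ∘ₗ (germ X.toSuperSheaf U hx).toLinearMap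

/-- The map `∑ f_i x_A ∘ ∂/∂x_i + ∑ F_j x_A ∘ ∂/∂θ_j : 𝒪(U) → A` in a chart around `x`. -/
def APoint.coordDer (xA : X.APoint x A) (c : SuperChart X.toSuperSheaf p q) (hc : x ∈ c.source)
    (U : Opens M) (hx : x ∈ U) (f : Fin p → A) (F : Fin q → A) : X.obj U →ₗ[ℝ] A :=
  ∑ i, f i • xA.compVF U hx (vfGerm X.toSuperSheaf c.source hc (c.dx i)) +
    ∑ j, F j • xA.compVF U hx (vfGerm X.toSuperSheaf c.source hc (c.dθ j))

/-- The left `A`-module `Der_{x_A}(𝒪(U), A)` of the `x_A`-derivations of `U`. -/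
abbrev APoint.Der [CommSuperalgebra A] (xA : X.APoint x A) (U : Opens M) (hx : x ∈ U) :
    Submodule A (X.obj U →ₗ[ℝ] A) :=
  superDer (xA.on U hx)

end Supermanifold

end SuperGeom

end

/-! The modules of derivations and `A ⊗ T_x(M)` are free over `A` on the `p + q` coordinate vector
fields, and a module spanned by those fields and mapped onto a basis is free too. Every isomorphism
is a comparison of such bases.

Derivations along an `A`-point are local. If `s` has germ zero at `x`, some even section `b` with
germ `1` satisfies `b s = 0`, and the Leibniz rule for `b s` gives `X(s) = 0`. The same bump
sections, which exist because `M` is Hausdorff, extend every germ to a section over a prescribed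
`U`. Hence derivations of `𝒪(U)` and of the stalk agree, whatever `U` is
(`superDerPrecomp_germ_bijective`).

On the stalk, a chart represents every germ by a superfunction on `ℝ^{p|q}`. The point `x_A` sends
each centred coordinate `x_i - x_i(x)` into the nilpotent ideal `N`: otherwise an invertible germ
would have nilpotent image. If a homogeneous `X` kills all coordinates, Hadamard's expansion `f = r
+ ∑ (x_i - u_i) g_i` gives `X(f) ∈ ∑ N X(g_i)`; iterating, `X(f)` lies in `N^m A` for all `m`, so it
vanishes, and the Leibniz rule takes care of the Grassmann factor (`homogDer_eq_zero_of_coord`). So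
a derivation is determined by its values on the coordinates. These values are arbitrary, since the
maps `x_A ∘ ∂/∂x_i`, `x_A ∘ ∂/∂θ_j` are dual to the coordinates (`coordValue_bijective`). The case
`A = ℝ`, along `ev_x`, gives a basis of `T_x(M)`, and base change one of `A ⊗ T_x(M)`.

For `A ⊗_{x_A} 𝒯_{M,x}` it remains to see that coordinate fields span the germs of vector fields
(`exists_vfGerm_eq_sum`): after subtracting the combination with the same values on the coordinates,
a vector field vanishes by the same Hadamard argument, applied at each point of the chart with
values in the Grassmann algebra. The spanning family goes to a basis of the derivations, so the map
is bijective (`rhoToDer_bijective`). -/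

noncomputable section

namespace SuperGeom

open Parity (par)

/-! ### Hadamard's lemma -/

section ParametricIntegral

variable {E : Type} [NormedAddCommGroup E] [NormedSpace ℝ E] [FiniteDimensional ℝ E]

/-- Differentiation under the integral sign for a continuously differentiable integrand. -/
theorem hasFDerivAt_intervalIntegral_of_contDiff {G : Type} [NormedAddCommGroup G]
    [NormedSpace ℝ G] {F : E × ℝ → G} (hF : ContDiff ℝ 1 F) (y : E) :
    HasFDerivAt (fun y => ∫ t in (0 : ℝ)..1, F (y, t))
      (∫ t in (0 : ℝ)..1, (fderiv ℝ F (y, t)).comp (ContinuousLinearMap.inl ℝ E ℝ)) y := by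
  have hd : Continuous fun z : E × ℝ =>
      (fderiv ℝ F z).comp (ContinuousLinearMap.inl ℝ E ℝ) :=
    (hF.continuous_fderiv one_ne_zero).clm_comp continuous_const
  -- The derivative is bounded on a compact set, so a constant serves as dominating function near
  -- `y`; the radius `1` plays no role.
  obtain ⟨C, hC⟩ := ((isCompact_closedBall y 1).prod
    (isCompact_Icc (a := (0 : ℝ)) (b := 1))).exists_bound_of_continuousOn hd.continuousOn
  refine intervalIntegral.hasFDerivAt_integral_of_dominated_of_fderiv_le
    (F := fun y t => F (y, t))
    (F' := fun y t => (fderiv ℝ F (y, t)).comp (ContinuousLinearMap.inl ℝ E ℝ))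
    (bound := fun _ => C) (Metric.closedBall_mem_nhds y one_pos) ?_ ?_ ?_ ?_ ?_ ?_
  · exact Filter.Eventually.of_forall fun z =>
      (hF.continuous.comp (by fun_prop : Continuous fun t : ℝ => (z, t))).aestronglyMeasurable
  · exact (hF.continuous.comp
      (by fun_prop : Continuous fun t : ℝ => (y, t))).intervalIntegrable _ _
  · exact (hd.comp (by fun_prop : Continuous fun t : ℝ => (y, t))).aestronglyMeasurable
  · refine Filter.Eventually.of_forall fun t ht z hz => hC (z, t) ⟨hz, ?_⟩
    rw [Set.uIoc_of_le zero_le_one] at ht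
    exact ⟨ht.1.le, ht.2⟩
  · exact intervalIntegrable_const
  · refine Filter.Eventually.of_forall fun t _ z _ => ?_
    exact ((hF.differentiable one_ne_zero (z, t)).hasFDerivAt).comp z
      (hasFDerivAt_prodMk_left z t)

/-- An integral depending smoothly on a parameter is smooth. -/
theorem contDiff_intervalIntegral {G : Type} [NormedAddCommGroup G] [NormedSpace ℝ G]
    {F : E × ℝ → G} (hF : ContDiff ℝ ∞ F) :
    ContDiff ℝ ∞ fun y => ∫ t in (0 : ℝ)..1, F (y, t) := by
  refine contDiff_infty.2 fun n => ?_
  -- The target has to vary: the derivative of the integral is an integral of the same kind, with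
  -- values in `E →L[ℝ] G`.
  induction n generalizing G with
  | zero =>
    exact contDiff_zero.2 (intervalIntegral.continuous_parametric_intervalIntegral_of_continuous'
      (f := fun y t => F (y, t)) hF.continuous 0 1)
  | succ n ih =>
    refine contDiff_succ_iff_hasFDerivAt.2 ⟨_, ?_,
      hasFDerivAt_intervalIntegral_of_contDiff (hF.of_le (by simp))⟩
    exact ih (F := fun z => (fderiv ℝ F z).comp (ContinuousLinearMap.inl ℝ E ℝ))
      ((hF.fderiv_right le_rfl).clm_comp contDiff_const)

/-- Hadamard's lemma: `f(y) - f(u)` is the value at `y - u` of a linear form depending smoothly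
on `y`. -/
theorem exists_contDiff_sub_eq {f : E → ℝ} (hf : ContDiff ℝ ∞ f) (u : E) :
    ∃ L : E → E →L[ℝ] ℝ, ContDiff ℝ ∞ L ∧ ∀ y, f y - f u = L y (y - u) := by
  have hsm : ContDiff ℝ ∞ fun z : E × ℝ => fderiv ℝ f (u + z.2 • (z.1 - u)) :=
    (hf.fderiv_right le_rfl).comp (by fun_prop)
  -- `L y` is the mean of the derivative of `f` over the segment from `u` to `y`; the identity is
  -- the fundamental theorem of calculus along that segment.
  refine ⟨fun y => ∫ t in (0 : ℝ)..1, fderiv ℝ f (u + t • (y - u)),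
    contDiff_intervalIntegral (F := fun z => fderiv ℝ f (u + z.2 • (z.1 - u))) hsm,
    fun y => ?_⟩
  have hc : Continuous fun t : ℝ => fderiv ℝ f (u + t • (y - u)) :=
    hsm.continuous.comp (by fun_prop : Continuous fun t : ℝ => (y, t))
  have hline : ∀ t : ℝ, HasDerivAt (fun t : ℝ => f (u + t • (y - u)))
      (fderiv ℝ f (u + t • (y - u)) (y - u)) t := fun t =>
    ((hf.differentiable (by simp) _).hasFDerivAt).comp_hasDerivAt t
      (by simpa using ((hasDerivAt_id t).smul_const (y - u)).const_add u)
  have := intervalIntegral.integral_eq_sub_of_hasDerivAt (a := 0) (b := 1)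
    (fun t _ => hline t) ((hc.clm_apply continuous_const).intervalIntegrable _ _)
  rw [ContinuousLinearMap.intervalIntegral_apply (hc.intervalIntegrable _ _), this]
  simp

end ParametricIntegral

/-! ### Smooth functions on open subsets of `ℝ^p` -/

section SmoothFunctions

variable {p q : ℕ} {U V : Opens (EuclideanSpace ℝ (Fin p))}

/-- The restriction to `U` of a smooth function on `ℝ^p`. -/
def SmoothFun.ofContDiff (U : Opens (EuclideanSpace ℝ (Fin p)))
    (g : EuclideanSpace ℝ (Fin p) → ℝ) (hg : ContDiff ℝ ∞ g) : SmoothFun p U :=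
  ⟨fun y => g y, fun _ => contMDiffAt_subtype_iff.2 (hg.contMDiff _)⟩

@[simp]
theorem SmoothFun.ofContDiff_apply (g : EuclideanSpace ℝ (Fin p) → ℝ) (hg : ContDiff ℝ ∞ g)
    (y : U) : SmoothFun.ofContDiff U g hg y = g y := rfl

@[simp]
theorem smoothRes_apply (h : V ≤ U) (f : SmoothFun p U) (y : V) :
    smoothRes h f y = f ⟨y.1, h y.2⟩ := rfl

/-- The coordinate functions of `U ⊆ ℝ^p`. -/
def smoothCoord (U : Opens (EuclideanSpace ℝ (Fin p))) (i : Fin p) : SmoothFun p U :=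
  SmoothFun.ofContDiff U (fun y => y i) (by fun_prop)

theorem smoothPartial_ofContDiff (i : Fin p) (g : EuclideanSpace ℝ (Fin p) → ℝ)
    (hg : ContDiff ℝ ∞ g) (y : U) :
    smoothPartial i (SmoothFun.ofContDiff U g hg) y =
      fderiv ℝ g y (EuclideanSpace.single i 1) := by
  rw [smoothPartial_apply, (extendZero_eventuallyEq _ g y
    ⟨U, le_rfl, y.2, fun _ _ => rfl⟩).fderiv_eq]

theorem smoothPartial_smoothCoord (i l : Fin p) :
    smoothPartial i (smoothCoord U l) = if l = i then 1 else 0 := by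
  ext y
  rw [smoothCoord, smoothPartial_ofContDiff]
  have : fderiv ℝ (fun y : EuclideanSpace ℝ (Fin p) => y l) y.1 = EuclideanSpace.proj l :=
    (EuclideanSpace.proj (𝕜 := ℝ) l).hasFDerivAt.fderiv
  rw [this]
  split_ifs with h <;> simp [h]

/-- Hadamard's lemma in coordinates. -/
theorem smoothFun_hadamard (f : SmoothFun p ⊤) (u : EuclideanSpace ℝ (Fin p)) :
    ∃ (r : ℝ) (g : Fin p → SmoothFun p ⊤), f = algebraMap ℝ _ r +
      ∑ i, (smoothCoord ⊤ i - algebraMap ℝ _ (u i)) * g i := by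
  -- The domain is all of `ℝ^p`, so extension by zero changes nothing and every segment issuing from
  -- `u` stays in the domain.
  have hf : ContDiff ℝ ∞ (extendZero f) :=
    contDiff_iff_contDiffAt.2 fun y => contDiffAt_extendZero f ⟨y, trivial⟩
  obtain ⟨L, hL, h⟩ := exists_contDiff_sub_eq hf u
  refine ⟨extendZero f u, fun i => SmoothFun.ofContDiff ⊤
    (fun y => L y (EuclideanSpace.single i 1)) (hL.clm_apply contDiff_const), ?_⟩
  ext y
  have hy := h y
  rw [extendZero_apply, sub_eq_iff_eq_add'] at hy
  have hsum : y.1 - u = ∑ i, (y.1 i - u i) • EuclideanSpace.single i (1 : ℝ) := by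
    ext j
    simp [Finset.sum_apply, Pi.single_apply]
  rw [hy, hsum, map_sum]
  have hev : ∀ F : SmoothFun p ⊤, F y = ContMDiffMap.evalRingHom y F := fun _ => rfl
  rw [hev, map_add, map_sum]
  congr 1
  refine Finset.sum_congr rfl fun i _ => ?_
  rw [map_smul, map_mul]
  rfl

/-- A smooth function which is compactly supported in `V`, and `1` near `u`. -/
theorem exists_smooth_bump {u : EuclideanSpace ℝ (Fin p)} (hu : u ∈ V) :
    ∃ (ψ : EuclideanSpace ℝ (Fin p) → ℝ) (_ : ContDiff ℝ ∞ ψ)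
      (N : Opens (EuclideanSpace ℝ (Fin p))),
      IsCompact (tsupport ψ) ∧ tsupport ψ ⊆ V ∧ u ∈ N ∧ N ≤ V ∧ ∀ y ∈ N, ψ y = 1 := by
  obtain ⟨ε, hε, hV⟩ := Metric.nhds_basis_closedBall.mem_iff.1 (V.isOpen.mem_nhds hu)
  -- The function is `1` on the ball of radius `ε / 2`, and its support is the closed ball of radius
  -- `ε`, which lies in `V`.
  let b : ContDiffBump u := ⟨ε / 2, ε, by positivity, by linarith⟩
  refine ⟨b, b.contDiff, ⟨Metric.ball u (ε / 2), Metric.isOpen_ball⟩, b.hasCompactSupport,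
    ?_, Metric.mem_ball_self (by positivity), ?_, fun y hy => ?_⟩
  · rw [b.tsupport_eq]; exact hV
  · refine fun y hy => hV (Metric.ball_subset_closedBall ?_)
    exact Metric.ball_subset_ball (by linarith : ε / 2 ≤ ε) hy
  · exact b.one_of_mem_closedBall (Metric.ball_subset_closedBall hy)

/-- Multiplication by a function supported in `V` extends functions on `V` to `ℝ^p`. -/
def smoothExtend (ψ : EuclideanSpace ℝ (Fin p) → ℝ) (hψ : ContDiff ℝ ∞ ψ)
    (h : tsupport ψ ⊆ V) : SmoothFun p V →ₗ[ℝ] SmoothFun p ⊤ where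
  toFun f := SmoothFun.ofContDiff ⊤ (fun y => ψ y * extendZero f y) <| by
    refine contDiff_iff_contDiffAt.2 fun y => ?_
    -- At points of `V` this is a product of smooth functions. Any other point has a neighbourhood
    -- where `ψ` is zero, because the closed support of `ψ` lies in `V`.
    by_cases hy : y ∈ V
    · exact hψ.contDiffAt.mul (contDiffAt_extendZero f ⟨y, hy⟩)
    · have h0 : (fun y => ψ y * extendZero f y) =ᶠ[nhds y] fun _ => 0 := by
        filter_upwards [notMem_tsupport_iff_eventuallyEq.1 fun h' => hy (h h')] with z hz
        rw [hz, Pi.zero_apply, zero_mul]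
      exact contDiffAt_const.congr_of_eventuallyEq h0
  map_add' f g := by
    ext y
    rw [ContMDiffMap.coe_add, Pi.add_apply]
    simp only [SmoothFun.ofContDiff_apply]
    by_cases hy : y.1 ∈ V
    · have e := fun k : SmoothFun p V => extendZero_apply k ⟨y.1, hy⟩
      simp only [e, ContMDiffMap.coe_add, Pi.add_apply, mul_add]
    · rw [image_eq_zero_of_notMem_tsupport fun h' => hy (h h')]
      simp
  map_smul' c f := by
    ext y
    rw [ContMDiffMap.coe_smul, Pi.smul_apply]
    simp only [SmoothFun.ofContDiff_apply]
    by_cases hy : y.1 ∈ V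
    · have e := fun k : SmoothFun p V => extendZero_apply k ⟨y.1, hy⟩
      simp only [e, ContMDiffMap.coe_smul, Pi.smul_apply, smul_eq_mul, RingHom.id_apply]
      ring
    · rw [image_eq_zero_of_notMem_tsupport fun h' => hy (h h')]
      simp

theorem smoothExtend_apply (ψ : EuclideanSpace ℝ (Fin p) → ℝ) (hψ : ContDiff ℝ ∞ ψ)
    (h : tsupport ψ ⊆ V) (f : SmoothFun p V) (y : (⊤ : Opens (EuclideanSpace ℝ (Fin p)))) :
    smoothExtend ψ hψ h f y = ψ y * extendZero f y := rfl

/-- Near each point of `U`, the functions on `U` coincide with functions on `ℝ^p`. -/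
theorem exists_smoothExtend {u : EuclideanSpace ℝ (Fin p)} (hu : u ∈ V) :
    ∃ (N : Opens (EuclideanSpace ℝ (Fin p))) (hN : N ≤ V)
      (e : SmoothFun p V →ₗ[ℝ] SmoothFun p ⊤), u ∈ N ∧
      ∀ f, smoothRes le_top (e f) = smoothRes hN f := by
  obtain ⟨ψ, hψ, N, -, hs, hu, hN, h1⟩ := exists_smooth_bump hu
  refine ⟨N, hN, smoothExtend ψ hψ hs, hu, fun f => ?_⟩
  ext y
  rw [smoothRes_apply, smoothRes_apply, smoothExtend_apply, h1 y.1 y.2, one_mul]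
  exact extendZero_apply f ⟨y.1, hN y.2⟩

end SmoothFunctions

/-! ### Composition of derivations with morphisms -/

section Composition

variable {B A C : Type*} [Ring B] [Algebra ℝ B] [Parity B] [Ring A] [Algebra ℝ A] [Parity A]
  [Ring C] [Algebra ℝ C] [Parity C]

theorem homogDer_precomp {φ : SuperHom A C} {k : ZMod 2} {X : A →ₗ[ℝ] C}
    (hX : X ∈ homogDer φ k) (ψ : SuperHom B A) :
    X ∘ₗ ψ.toAlgHom.toLinearMap ∈ homogDer (φ.comp ψ) k := by
  refine ⟨fun j s hs => hX.1 j _ (ψ.map_par j s hs), fun j s hs t => ?_⟩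
  show X (ψ (s * t)) = _
  rw [map_mul]
  exact hX.2 j _ (ψ.map_par j s hs) _

theorem homogDer_postcomp {φ : SuperHom B A} {k : ZMod 2} {X : B →ₗ[ℝ] A}
    (hX : X ∈ homogDer φ k) (ψ : SuperHom A C) :
    ψ.toAlgHom.toLinearMap ∘ₗ X ∈ homogDer (ψ.comp φ) k := by
  refine ⟨fun j s hs => ψ.map_par _ _ (hX.1 j s hs), fun j s hs t => ?_⟩
  show ψ (X (s * t)) = ψ (X s) * ψ (φ t) + sgn k j • (ψ (φ s) * ψ (X t))
  rw [hX.2 j s hs t, map_add, map_smul, map_mul, map_mul]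

/-- Gluing gives sections without control of their parity. By this compatibility a glued section can
be replaced by a homogeneous component without changing those restrictions that already have the
right parity. -/
theorem SuperHom.map_decompose [CommSuperalgebra B] [CommSuperalgebra A] (φ : SuperHom B A)
    (b : B) (j : ZMod 2) :
    φ (DirectSum.decompose par b j : B) = (DirectSum.decompose par (φ b) j : A) := by
  induction b using DirectSum.Decomposition.inductionOn (par : ZMod 2 → Submodule ℝ B) with
  | zero => simp
  | @homogeneous i m =>
    by_cases h : i = j
    · subst h
      rw [DirectSum.decompose_of_mem_same _ m.2,
        DirectSum.decompose_of_mem_same _ (φ.map_par _ _ m.2)]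
    · rw [DirectSum.decompose_of_mem_ne _ m.2 h,
        DirectSum.decompose_of_mem_ne _ (φ.map_par _ _ m.2) h, map_zero]
  | add m m' h h' => simp only [map_add, DirectSum.decompose_add, DirectSum.add_apply,
      Submodule.coe_add, h, h']

end Composition

theorem sgn_zero_right (k : ZMod 2) : sgn k 0 = 1 := by simp [sgn]

/-! ### The global model -/

section GlobalModel

variable {p q : ℕ} {U V W : Opens (EuclideanSpace ℝ (Fin p))}

/-- The even coordinates of `U ⊆ ℝ^{p|q}`. -/
def evenCoord (q : ℕ) (U : Opens (EuclideanSpace ℝ (Fin p))) (i : Fin p) : SuperFun p q U :=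
  smoothCoord U i ⊗ₜ 1

/-- The odd coordinates of `U ⊆ ℝ^{p|q}`. -/
def oddCoord (U : Opens (EuclideanSpace ℝ (Fin p))) (j : Fin q) : SuperFun p q U :=
  1 ⊗ₜ ExteriorAlgebra.ι ℝ (Pi.single j 1)

theorem evenCoord_mem (i : Fin p) : evenCoord q U i ∈ (par 0 : Submodule ℝ (SuperFun p q U)) :=
  tmul_mem_par _ SetLike.GradedOne.one_mem

theorem oddCoord_mem (j : Fin q) : oddCoord U j ∈ (par 1 : Submodule ℝ (SuperFun p q U)) :=
  tmul_mem_par _ (CliffordAlgebra.ι_mem_evenOdd_one _ _)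

theorem modelDx_evenCoord (i l : Fin p) :
    modelDx q i (evenCoord q U l) = if l = i then 1 else 0 := by
  rw [modelDx, evenCoord, LinearMap.rTensor_tmul, smoothPartial_smoothCoord]
  split_ifs
  · rfl
  · exact TensorProduct.zero_tmul _ _

theorem modelDx_oddCoord (i : Fin p) (j : Fin q) : modelDx q i (oddCoord U j) = 0 := by
  have h : smoothPartial i (1 : SmoothFun p U) = 0 := by
    have := smoothPartial_mul i (1 : SmoothFun p U) 1
    simpa using this
  rw [modelDx, oddCoord, LinearMap.rTensor_tmul, h, TensorProduct.zero_tmul]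

theorem modelDθ_evenCoord (j : Fin q) (i : Fin p) : modelDθ j (evenCoord q U i) = 0 := by
  rw [modelDθ, evenCoord, LinearMap.lTensor_tmul, grassmannPartial,
    CliffordAlgebra.contractLeft_one, TensorProduct.tmul_zero]

theorem modelDθ_oddCoord (j l : Fin q) :
    modelDθ j (oddCoord U l) = if l = j then 1 else 0 := by
  rw [modelDθ, oddCoord, LinearMap.lTensor_tmul, grassmannPartial, ExteriorAlgebra.ι,
    CliffordAlgebra.contractLeft_ι, LinearMap.proj_apply, Pi.single_apply]
  by_cases h : l = j
  · rw [if_pos h, if_pos h.symm, map_one]; rfl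
  · rw [if_neg h, if_neg (Ne.symm h), map_zero, TensorProduct.tmul_zero]

theorem modelRes_modelRes (hVU : V ≤ U) (hWV : W ≤ V) (s : SuperFun p q U) :
    modelRes q hWV (modelRes q hVU s) = modelRes q (hWV.trans hVU) s := by
  induction s using TensorProduct.induction_on with
  | zero => simp
  | add x y hx hy => simp only [map_add, hx, hy]
  | tmul f α => rfl

theorem modelRes_par (h : V ≤ U) {k : ZMod 2} {s : SuperFun p q U} (hs : s ∈ par k) :
    modelRes q h s ∈ par k := by
  refine par_induction (P := fun s => modelRes q h s ∈ par k) ?_ ?_ ?_ hs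
  · intro f α hα
    exact tmul_mem_par _ hα
  · rw [map_zero]; exact Submodule.zero_mem _
  · intro s t hs ht; rw [map_add]; exact Submodule.add_mem _ hs ht

/-- A derivation of `C^∞(ℝ^p) ⊗ Λ` along a morphism which is infinitesimally close to a point
vanishes if it vanishes on the coordinates. -/
theorem homogDer_eq_zero_of_coord {A : Type*} [Ring A] [Algebra ℝ A] [Parity A]
    (φ : SuperHom (SuperFun p q ⊤) A) {N : Submodule ℝ A} {n : ℕ} (hN : N ^ n = ⊥)
    (u : EuclideanSpace ℝ (Fin p)) (hu : ∀ i, φ (evenCoord q ⊤ i) - algebraMap ℝ A (u i) ∈ N)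
    {k : ZMod 2} {Y : SuperFun p q ⊤ →ₗ[ℝ] A} (hY : Y ∈ homogDer φ k)
    (hx : ∀ i, Y (evenCoord q ⊤ i) = 0) (hθ : ∀ j, Y (oddCoord ⊤ j) = 0) : Y = 0 := by
  have even : ∀ f : SmoothFun p ⊤,
      f ⊗ₜ[ℝ] 1 ∈ (par 0 : Submodule ℝ (SuperFun p q ⊤)) := fun f =>
    tmul_mem_par f SetLike.GradedOne.one_mem
  have leib : ∀ (f : SmoothFun p ⊤) (t : SuperFun p q ⊤),
      Y (f ⊗ₜ 1 * t) = Y (f ⊗ₜ 1) * φ t + φ (f ⊗ₜ 1) * Y t := fun f t => by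
    rw [hY.2 0 _ (even f) t, sgn_zero_right, one_smul]
  -- The Leibniz rule for `1 * 1` reads `Y 1 = Y 1 + Y 1`.
  have one : Y 1 = 0 := by
    have h := leib 1 1
    have hφ : φ 1 = 1 := map_one φ.toAlgHom
    rw [← Algebra.TensorProduct.one_def, hφ, one_mul, one_mul, mul_one] at h
    exact left_eq_add.1 h
  have const : ∀ r : ℝ, Y (algebraMap ℝ _ r) = 0 := fun r => by
    rw [Algebra.algebraMap_eq_smul_one, map_smul, one, smul_zero]
  -- Each use of Hadamard's lemma gains a factor in `N`: since `Y` kills constants and coordinates,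
  -- only the terms `φ(x_i - u_i) Y(g_i)` survive. As `N` is a mere subspace here, `N ^ m * ⊤`
  -- replaces the power of an ideal and makes the case `m = 0` empty.
  have smooth_mem : ∀ (m : ℕ) (f : SmoothFun p ⊤), Y (f ⊗ₜ 1) ∈ N ^ m * ⊤ := by
    intro m
    induction m with
    | zero => intro f; rw [pow_zero, one_mul]; trivial
    | succ m ih =>
      intro f
      obtain ⟨r, g, rfl⟩ := smoothFun_hadamard f u
      have e : (algebraMap ℝ (SmoothFun p ⊤) r +
          ∑ i, (smoothCoord ⊤ i - algebraMap ℝ _ (u i)) * g i) ⊗ₜ[ℝ] (1 : Grassmann q) =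
          algebraMap ℝ (SuperFun p q ⊤) r + ∑ i,
            (smoothCoord ⊤ i - algebraMap ℝ _ (u i)) ⊗ₜ[ℝ] (1 : Grassmann q) * g i ⊗ₜ 1 := by
        simp only [TensorProduct.add_tmul, TensorProduct.sum_tmul,
          Algebra.TensorProduct.tmul_mul_tmul, mul_one]
        rfl
      have ec : ∀ i, (smoothCoord ⊤ i - algebraMap ℝ (SmoothFun p ⊤) (u i)) ⊗ₜ[ℝ]
          (1 : Grassmann q) = evenCoord q ⊤ i - algebraMap ℝ (SuperFun p q ⊤) (u i) := fun i => by
        rw [TensorProduct.sub_tmul]; rfl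
      rw [e, map_add, const, zero_add, map_sum]
      refine Submodule.sum_mem _ fun i _ => ?_
      rw [leib, ec, map_sub, map_sub, hx, const, sub_zero, zero_mul, zero_add, AlgHom.commutes,
        pow_succ', mul_assoc]
      exact Submodule.mul_mem_mul (hu i) (ih _)
  have smooth : ∀ f : SmoothFun p ⊤, Y (f ⊗ₜ 1) = 0 := fun f => by
    have := smooth_mem n f
    rwa [hN, Submodule.bot_mul, Submodule.mem_bot] at this
  have grass_ι : ∀ v : Fin q → ℝ, Y (1 ⊗ₜ ExteriorAlgebra.ι ℝ v) = 0 := fun v => by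
    rw [pi_eq_sum_univ' v, map_sum, TensorProduct.tmul_sum, map_sum]
    refine Finset.sum_eq_zero fun j _ => ?_
    rw [map_smul, TensorProduct.tmul_smul, map_smul]
    have := hθ j
    rw [oddCoord] at this
    convert smul_zero (v j)
  -- The Grassmann algebra is generated by odd vectors, so peeling off one generator on the left at
  -- a time requires the signed Leibniz rule only for odd first factors.
  have grass : ∀ α : Grassmann q, Y (1 ⊗ₜ α) = 0 := fun α => by
    induction α using CliffordAlgebra.left_induction with
    | algebraMap r =>
      rw [Algebra.algebraMap_eq_smul_one, TensorProduct.tmul_smul, map_smul,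
        ← Algebra.TensorProduct.one_def, one, smul_zero]
    | add a b ha hb => rw [TensorProduct.tmul_add, map_add, ha, hb, add_zero]
    | ι_mul a v ha =>
      have e : (1 : SmoothFun p ⊤) ⊗ₜ[ℝ] (CliffordAlgebra.ι 0 v * a : Grassmann q) =
          (1 ⊗ₜ CliffordAlgebra.ι 0 v) * (1 ⊗ₜ a) := by
        rw [Algebra.TensorProduct.tmul_mul_tmul, one_mul]
      rw [e, hY.2 1 _ (tmul_mem_par _ (CliffordAlgebra.ι_mem_evenOdd_one _ _)), ha, mul_zero,
        smul_zero, add_zero]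
      convert zero_mul _
      exact grass_ι v
  refine TensorProduct.ext' fun f α => ?_
  have e : f ⊗ₜ[ℝ] α = f ⊗ₜ 1 * 1 ⊗ₜ α := by
    rw [Algebra.TensorProduct.tmul_mul_tmul, one_mul, mul_one]
  show Y (f ⊗ₜ α) = 0
  rw [e, leib, smooth, grass, zero_mul, mul_zero, add_zero]

/-- The Grassmann algebra as a superalgebra. -/
instance : Parity (Grassmann q) where
  par := CliffordAlgebra.evenOdd (0 : QuadraticForm ℝ (Fin q → ℝ))

/-- The evaluation of the coefficients of a superfunction at `u`. -/
def modelEvalGrassmann (q : ℕ) (u : U) : SuperHom (SuperFun p q U) (Grassmann q) where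
  toAlgHom := Algebra.TensorProduct.lift
    ((Algebra.ofId ℝ (Grassmann q)).comp
      ({ ContMDiffMap.evalRingHom u with commutes' := fun _ => rfl } : SmoothFun p U →ₐ[ℝ] ℝ))
    (AlgHom.id ℝ (Grassmann q)) (fun f α => Algebra.commute_algebraMap_left (f u) α)
  map_par k s hs := by
    refine par_induction (P := fun s => Algebra.TensorProduct.lift _ _ _ s ∈ par k) ?_ ?_ ?_ hs
    · intro f α hα
      show algebraMap ℝ (Grassmann q) (f u) * α ∈ _
      rw [← Algebra.smul_def]
      exact Submodule.smul_mem _ _ hα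
    · rw [map_zero]; exact Submodule.zero_mem _
    · intro s t hs ht; rw [map_add]; exact Submodule.add_mem _ hs ht

theorem modelEvalGrassmann_tmul (u : U) (f : SmoothFun p U) (α : Grassmann q) :
    modelEvalGrassmann q u (f ⊗ₜ α) = f u • α :=
  (Algebra.smul_def (f u) α).symm

/-- In a basis of the Grassmann algebra, a superfunction is a finite combination with smooth
coefficients, and linear independence annihilates their values at each point. Real-valued evaluation
would not suffice, since it forgets the `θ_j`. -/
theorem superFun_eq_zero {s : SuperFun p q U} (h : ∀ u : U, modelEvalGrassmann q u s = 0) :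
    s = 0 := by
  let b := Module.Free.chooseBasis ℝ (Grassmann q)
  obtain ⟨f, rfl⟩ := (TensorProduct.equivFinsuppOfBasisRight (M := SmoothFun p U) b).symm.surjective s
  suffices hf : f = 0 by rw [hf, map_zero]
  ext i u
  have hu := h u
  rw [TensorProduct.equivFinsuppOfBasisRight_symm_apply, Finsupp.sum, map_sum] at hu
  simp only [modelEvalGrassmann_tmul] at hu
  by_cases hi : i ∈ f.support
  · exact linearIndependent_iff'.1 b.linearIndependent f.support (fun i => f i u) hu i hi
  · rw [Finsupp.notMem_support_iff.1 hi]; rfl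

end GlobalModel

/-! ### Gluing two sections -/

section Gluing

variable {M : Type u} [TopologicalSpace M] (F : SuperSheaf.{u, v} M)

theorem SuperSheaf.eq_of_locally_eq {U : Opens M} {ι : Type u} (V : ι → Opens M)
    (hV : ∀ i, V i ≤ U) (hU : U ≤ iSup V) {s t : F.obj U}
    (h : ∀ i, F.res (hV i) s = F.res (hV i) t) : s = t := by
  obtain rfl : U = iSup V := le_antisymm hU (iSup_le hV)
  refine (F.exists_unique_glue V (fun i => F.res (hV i) t) fun i j => ?_).unique h fun _ => rfl
  rw [F.res_res, F.res_res]

theorem SuperSheaf.eq_of_eq₂ {U P Q : Opens M} (hP : P ≤ U) (hQ : Q ≤ U) (hU : U ≤ P ⊔ Q)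
    {s t : F.obj U} (h₁ : F.res hP s = F.res hP t) (h₂ : F.res hQ s = F.res hQ t) : s = t := by
  -- The two-element index set is lifted because the sheaf axiom quantifies over covers indexed in
  -- the universe of `M`.
  refine F.eq_of_locally_eq (fun b : ULift.{u} Bool => bif b.down then P else Q) ?_ ?_ ?_
  · rintro ⟨_ | _⟩
    · exact hQ
    · exact hP
  · exact hU.trans (sup_le (le_iSup_of_le ⟨true⟩ le_rfl) (le_iSup_of_le ⟨false⟩ le_rfl))
  · rintro ⟨_ | _⟩
    · exact h₂
    · exact h₁

theorem SuperSheaf.exists_glue₂ {U P Q : Opens M} (hP : P ≤ U) (hQ : Q ≤ U) (hU : U ≤ P ⊔ Q)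
    (s : F.obj P) (t : F.obj Q)
    (h : F.res (inf_le_left : P ⊓ Q ≤ P) s = F.res (inf_le_right : P ⊓ Q ≤ Q) t) :
    ∃ r : F.obj U, F.res hP r = s ∧ F.res hQ r = t := by
  let V : ULift.{u} Bool → Opens M := fun b => bif b.down then P else Q
  let sec : ∀ b, F.obj (V b) := fun b => match b with
    | ⟨true⟩ => s
    | ⟨false⟩ => t
  have hUV : U ≤ iSup V :=
    hU.trans (sup_le (le_iSup_of_le (f := V) ⟨true⟩ le_rfl) (le_iSup_of_le (f := V) ⟨false⟩ le_rfl))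
  obtain ⟨r, hr, -⟩ := F.exists_unique_glue V sec (by
    rintro ⟨_ | _⟩ ⟨_ | _⟩
    · rfl
    -- The hypothesis lives on `P ⊓ Q`; for the pair in the opposite order it is carried to `Q ⊓ P`
    -- by restriction.
    · have := congrArg (F.res (le_inf inf_le_right inf_le_left : Q ⊓ P ≤ P ⊓ Q)) h
      rw [F.res_res, F.res_res] at this
      exact this.symm
    · exact h
    · rfl)
  refine ⟨F.res hUV r, ?_, ?_⟩
  · rw [F.res_res]; exact hr ⟨true⟩
  · rw [F.res_res]; exact hr ⟨false⟩

theorem eq_zero_of_germ_eq_zero {U : Opens M} (s : F.obj U)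
    (h : ∀ (x : M) (hx : x ∈ U), germ F U hx s = 0) : s = 0 := by
  have key : ∀ x : U, ∃ (W : Opens M) (_ : x.1 ∈ W) (hW : W ≤ U), F.res hW s = 0 := fun x => by
    obtain ⟨W, hx, hW, _, e⟩ := (germ_eq_iff F x.2 x.2 s 0).1 ((h x x.2).trans (map_zero _).symm)
    exact ⟨W, hx, hW, e.trans (map_zero _)⟩
  choose W hx hW e using key
  refine F.eq_of_locally_eq W hW (fun y hy => Opens.mem_iSup.2 ⟨⟨y, hy⟩, hx ⟨y, hy⟩⟩)
    fun i => ?_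
  rw [e, map_zero]

end Gluing

/-! ### The global model and the sections over the domain of a chart -/

namespace SuperChart

variable {M : Type u} [TopologicalSpace M] {F : SuperSheaf.{u, v} M} {p q : ℕ}
  (c : SuperChart F p q)

theorem res_iso_symm {W W' : Opens M} (hW : W ≤ c.source) (h : W' ≤ W)
    (s : SuperFun p q (c.image W)) :
    F.res h ((c.iso W hW).symm s) =
      (c.iso W' (h.trans hW)).symm (modelRes q (homeoImage_mono c.homeo h) s) := by
  rw [AlgEquiv.eq_symm_apply]
  exact (c.iso_res W W' hW h _).trans (by rw [AlgEquiv.apply_symm_apply])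

/-- The superfunctions on `ℝ^{p|q}` as sections over an open subset of a chart. -/
def pullback (W : Opens M) (hW : W ≤ c.source) : SuperHom (SuperFun p q ⊤) (F.obj W) where
  toAlgHom := ((c.iso W hW).symm : SuperFun p q (c.image W) →ₐ[ℝ] F.obj W).comp
    (modelRes q le_top)
  map_par k s hs := by
    refine (c.iso_par W hW k _).1 ?_
    show c.iso W hW ((c.iso W hW).symm (modelRes q le_top s)) ∈ par k
    rw [AlgEquiv.apply_symm_apply]
    exact modelRes_par le_top hs

theorem pullback_apply (W : Opens M) (hW : W ≤ c.source) (s : SuperFun p q ⊤) :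
    c.pullback W hW s = (c.iso W hW).symm (modelRes q le_top s) := rfl

theorem res_pullback {W W' : Opens M} (hW : W ≤ c.source) (h : W' ≤ W) (s : SuperFun p q ⊤) :
    F.res h (c.pullback W hW s) = c.pullback W' (h.trans hW) s := by
  rw [pullback_apply, res_iso_symm, modelRes_modelRes]
  rfl

variable {x : M} (hx : x ∈ c.source)

/-- The superfunctions on `ℝ^{p|q}` as germs at a point of a chart. -/
def toStalk : SuperHom (SuperFun p q ⊤) (Stalk F x) :=
  (germHom F c.source hx).comp (c.pullback c.source le_rfl)

theorem germ_pullback {W : Opens M} (hW : W ≤ c.source) (hxW : x ∈ W) (s : SuperFun p q ⊤) :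
    germ F W hxW (c.pullback W hW s) = c.toStalk hx s := by
  rw [← c.res_pullback le_rfl hW, germ_res]
  rfl

/-- The open subset of the domain of a chart corresponding to an open set of `ℝ^p`. -/
def preimage (N : Opens (EuclideanSpace ℝ (Fin p))) : Opens M :=
  ⟨c.homeo.source ∩ c.homeo ⁻¹' N, c.homeo.isOpen_inter_preimage N.isOpen⟩

theorem preimage_le (N : Opens (EuclideanSpace ℝ (Fin p))) : c.preimage N ≤ c.source :=
  fun _ hy => hy.1

theorem image_preimage_le (N : Opens (EuclideanSpace ℝ (Fin p))) :
    c.image (c.preimage N) ≤ N := by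
  rintro _ ⟨y, ⟨-, hy⟩, rfl⟩
  exact hy.2

theorem preimage_le_of_le_image {N : Opens (EuclideanSpace ℝ (Fin p))} {W : Opens M}
    (h : N ≤ c.image W) : c.preimage N ≤ W := by
  rintro y ⟨hy, hyN⟩
  obtain ⟨z, ⟨hz, hzW⟩, e⟩ := h hyN
  rwa [← c.homeo.injOn hz hy e]

theorem mem_image (hx : x ∈ c.source) {W : Opens M} (hxW : x ∈ W) : c.homeo x ∈ c.image W := ⟨x, ⟨hx, hxW⟩, rfl⟩

theorem mem_preimage (hx : x ∈ c.source) {N : Opens (EuclideanSpace ℝ (Fin p))} (h : c.homeo x ∈ N) :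
    x ∈ c.preimage N := ⟨hx, h⟩

/-- Sections over the domain of a chart that agree near the image of `x` have the same germ. -/
theorem toStalk_eq_germ {N : Opens (EuclideanSpace ℝ (Fin p))} (hN : c.homeo x ∈ N)
    {W : Opens M} (hW : W ≤ c.source) (hxW : x ∈ W) (hNW : N ≤ c.image W)
    {s : SuperFun p q ⊤} {t : SuperFun p q (c.image W)}
    (h : modelRes q (le_top : N ≤ ⊤) s = modelRes q hNW t) :
    c.toStalk hx s = germ F W hxW ((c.iso W hW).symm t) := by
  have hle : c.preimage N ≤ W := c.preimage_le_of_le_image hNW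
  rw [← c.germ_pullback hx (c.preimage_le N) (c.mem_preimage hx hN),
    ← germ_res F hle (c.mem_preimage hx hN), res_iso_symm, pullback_apply]
  have h' := congrArg (modelRes q (c.image_preimage_le N)) h
  rw [modelRes_modelRes, modelRes_modelRes] at h'
  rw [h']

theorem toStalk_eq_toStalk {N : Opens (EuclideanSpace ℝ (Fin p))} (hN : c.homeo x ∈ N)
    {s t : SuperFun p q ⊤}
    (h : modelRes q (le_top : N ≤ ⊤) s = modelRes q (le_top : N ≤ ⊤) t) :
    c.toStalk hx s = c.toStalk hx t := by
  -- `N` may leave the image of the chart, hence the intersection.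
  refine (c.toStalk_eq_germ hx (N := N ⊓ c.image c.source) ⟨hN, c.mem_image hx hx⟩ le_rfl hx
    inf_le_right (t := modelRes q le_top t) ?_)
  have h' := congrArg (modelRes q (inf_le_left : N ⊓ c.image c.source ≤ N)) h
  rw [modelRes_modelRes, modelRes_modelRes] at h'
  rw [h', modelRes_modelRes]

/-- Every germ is the germ of a superfunction on `ℝ^{p|q}`. -/
theorem toStalk_surjective : Function.Surjective (c.toStalk hx) := by
  intro g
  obtain ⟨W, hxW, s, rfl⟩ := exists_germ F g
  have hxW' : x ∈ W ⊓ c.source := ⟨hxW, hx⟩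
  -- One linear operator `e` extends all smooth functions, up to shrinking to `N`; by linearity it
  -- acts on the smooth factor of the tensor product.
  obtain ⟨N, hN, e, huN, he⟩ := exists_smoothExtend (c.mem_image hx hxW')
  let t := c.iso (W ⊓ c.source) inf_le_right (F.res inf_le_left s)
  refine ⟨LinearMap.rTensor (Grassmann q) e t, ?_⟩
  rw [c.toStalk_eq_germ hx huN inf_le_right hxW' hN (t := t), AlgEquiv.symm_apply_apply,
    germ_res]
  generalize t = t
  induction t using TensorProduct.induction_on with
  | zero => simp
  | add a b ha hb => simp only [map_add, ha, hb]
  | tmul f α =>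
    show smoothRes le_top (e f) ⊗ₜ[ℝ] α = smoothRes hN f ⊗ₜ α
    rw [he]

/-- A function which does not vanish at the image of `x` has an invertible germ at `x`. -/
theorem isUnit_toStalk {f : SmoothFun p ⊤} (hf : f ⟨c.homeo x, trivial⟩ ≠ 0) :
    IsUnit (c.toStalk hx (f ⊗ₜ 1)) := by
  -- The function is inverted where it does not vanish, and the inverse is replaced by a global
  -- function with the same restriction near the point.
  let V : Opens (EuclideanSpace ℝ (Fin p)) :=
    ⟨{y | f ⟨y, trivial⟩ ≠ 0}, isOpen_ne_fun
      (f.contMDiff.continuous.comp (by fun_prop)) continuous_const⟩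
  let f' : SmoothFun p V := ⟨fun y => (f ⟨y.1, trivial⟩)⁻¹, fun y =>
    ((contMDiffAt_subtype_iff (U := V) (x := y) (f := fun z => (extendZero f z)⁻¹)).2
      (((contDiffAt_extendZero f ⟨y.1, trivial⟩).inv
        (by rw [extendZero_apply f ⟨y.1, trivial⟩]; exact y.2)).contMDiffAt)).congr_of_eventuallyEq
      (Filter.Eventually.of_forall fun z => by
        show _ = (extendZero f z.1)⁻¹
        rw [extendZero_apply f ⟨z.1, trivial⟩])⟩
  obtain ⟨N, hN, e, huN, he⟩ := exists_smoothExtend (V := V) hf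
  have key : smoothRes (le_top : N ≤ ⊤) (f * e f') = 1 := by
    rw [map_mul, he]
    ext y
    exact mul_inv_cancel₀ (hN y.2)
  have h1 : c.toStalk hx ((f * e f') ⊗ₜ 1) = 1 := by
    refine (c.toStalk_eq_toStalk hx huN (t := 1) ?_).trans (map_one _)
    rw [map_one]
    show smoothRes _ (f * e f') ⊗ₜ[ℝ] (1 : Grassmann q) = 1
    rw [key]; rfl
  have h2 : (f * e f') ⊗ₜ[ℝ] (1 : Grassmann q) = f ⊗ₜ 1 * e f' ⊗ₜ 1 := by
    rw [Algebra.TensorProduct.tmul_mul_tmul, one_mul]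
  -- The stalk is treated as a noncommutative ring, so the inverse is checked on both sides;
  -- commutativity is used among smooth functions only.
  have h3 : (f * e f') ⊗ₜ[ℝ] (1 : Grassmann q) = e f' ⊗ₜ 1 * f ⊗ₜ 1 := by
    rw [Algebra.TensorProduct.tmul_mul_tmul, one_mul, mul_comm]
  refine isUnit_iff_exists.2 ⟨c.toStalk hx (e f' ⊗ₜ 1), ?_, ?_⟩
  · rw [← map_mul, ← h2, h1]
  · rw [← map_mul, ← h3, h1]

theorem act_dx_toStalk (i : Fin p) (s : SuperFun p q ⊤) :
    act F (vfGerm F c.source hx (c.dx i)) (c.toStalk hx s) = c.toStalk hx (modelDx q i s) := by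
  show act F _ (germ F c.source hx _) = germ F c.source hx _
  rw [act_germ]
  congr 1
  show (c.iso _ _).symm (modelDx q i (c.iso _ _ ((c.iso _ _).symm (modelRes q le_top s)))) =
    (c.iso _ _).symm (modelRes q le_top (modelDx q i s))
  rw [AlgEquiv.apply_symm_apply, modelRes_modelDx]

theorem act_dθ_toStalk (j : Fin q) (s : SuperFun p q ⊤) :
    act F (vfGerm F c.source hx (c.dθ j)) (c.toStalk hx s) = c.toStalk hx (modelDθ j s) := by
  show act F _ (germ F c.source hx _) = germ F c.source hx _
  rw [act_germ]
  congr 1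
  show (c.iso _ _).symm (modelDθ j (c.iso _ _ ((c.iso _ _).symm (modelRes q le_top s)))) =
    (c.iso _ _).symm (modelRes q le_top (modelDθ j s))
  rw [AlgEquiv.apply_symm_apply, modelRes_modelDθ]

/-! ### Bump sections -/

/-- Every neighbourhood `W ≤ U` of `x` carries an even section over `U` with germ `1` at `x` that
vanishes near the complement of `W`. -/
theorem exists_bump [T2Space M] (c : SuperChart F p q) (hx : x ∈ c.source)
    {U W : Opens M} (hWU : W ≤ U) (hxW : x ∈ W) :
    ∃ (φ : F.obj U) (Z : Opens M) (hZ : Z ≤ U), φ ∈ par 0 ∧ U ≤ W ⊔ Z ∧ F.res hZ φ = 0 ∧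
      germ F U (hWU hxW) φ = 1 := by
  obtain ⟨ψ, hψ, N, hcomp, hsupp, huN, hN, h1⟩ :=
    exists_smooth_bump (c.mem_image hx (W := W ⊓ c.source) ⟨hxW, hx⟩)
  have himg : ∀ y ∈ tsupport ψ, y ∈ c.homeo.target ∧ c.homeo.symm y ∈ W := by
    intro y hy
    obtain ⟨z, ⟨hz, hzW⟩, rfl⟩ := hsupp hy
    exact ⟨c.homeo.map_source hz, by rw [c.homeo.left_inv hz]; exact hzW.1⟩
  -- This is where the Hausdorff hypothesis enters: the support, carried to `M`, is compact and
  -- hence closed in all of `M`, so its complement is open.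
  have hK : IsCompact (c.homeo.symm '' tsupport ψ) :=
    hcomp.image_of_continuousOn (c.homeo.continuousOn_symm.mono fun y hy => (himg y hy).1)
  let Z : Opens M := U ⊓ ⟨(c.homeo.symm '' tsupport ψ)ᶜ, hK.isClosed.isOpen_compl⟩
  let P : Opens M := U ⊓ c.source
  let ψ' : SuperFun p q ⊤ := SmoothFun.ofContDiff ⊤ ψ hψ ⊗ₜ 1
  have hcover : U ≤ W ⊔ Z := by
    intro y hy
    by_cases hyK : y ∈ c.homeo.symm '' tsupport ψ
    · obtain ⟨z, hz, rfl⟩ := hyK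
      exact Or.inl (himg z hz).2
    · exact Or.inr ⟨hy, hyK⟩
  have hcover' : U ≤ P ⊔ Z := by
    intro y hy
    by_cases hyK : y ∈ c.homeo.symm '' tsupport ψ
    · obtain ⟨z, hz, rfl⟩ := hyK
      exact Or.inl ⟨hy, c.homeo.map_target (himg z hz).1⟩
    · exact Or.inr ⟨hy, hyK⟩
  -- The bump function on the chart is glued with zero off its support; on the overlap no point has
  -- its image in the support of `ψ`, so both sections vanish.
  obtain ⟨φ, hP, hZ⟩ := F.exists_glue₂ (U := U) (P := P) (Q := Z) inf_le_left inf_le_left hcover'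
    (c.pullback P inf_le_right ψ') 0 (by
      rw [map_zero, res_pullback, pullback_apply]
      convert map_zero (c.iso (P ⊓ Z) (inf_le_left.trans inf_le_right)).symm
      show smoothRes le_top (SmoothFun.ofContDiff ⊤ ψ hψ) ⊗ₜ[ℝ] (1 : Grassmann q) = 0
      have h0 : smoothRes (le_top : c.image (P ⊓ Z) ≤ ⊤) (SmoothFun.ofContDiff ⊤ ψ hψ) = 0 := by
        ext y
        obtain ⟨_, z, ⟨hz, hzZ⟩, rfl⟩ := y
        show ψ (c.homeo z) = 0
        refine image_eq_zero_of_notMem_tsupport fun h => hzZ.2.2 ⟨c.homeo z, h, ?_⟩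
        exact c.homeo.left_inv hz
      rw [h0, TensorProduct.zero_tmul])
  have hψ0 : ψ' ∈ (par 0 : Submodule ℝ (SuperFun p q ⊤)) :=
    tmul_mem_par _ SetLike.GradedOne.one_mem
  have hxP : x ∈ P := ⟨hWU hxW, hx⟩
  -- Passing to the even part is harmless: both pieces from which `φ` was glued are even.
  refine ⟨DirectSum.decompose par φ 0, Z, inf_le_left, SetLike.coe_mem _, hcover, ?_, ?_⟩
  · rw [SuperHom.map_decompose, hZ]
    simp
  · rw [← germ_res F (inf_le_left : P ≤ U) hxP, SuperHom.map_decompose, hP,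
      DirectSum.decompose_of_mem_same _ ((c.pullback P _).map_par 0 _ hψ0),
      c.germ_pullback hx]
    refine (c.toStalk_eq_toStalk hx huN (t := 1) ?_).trans (map_one _)
    rw [map_one]
    show smoothRes _ (SmoothFun.ofContDiff ⊤ ψ hψ) ⊗ₜ[ℝ] (1 : Grassmann q) = 1 ⊗ₜ 1
    congr 1
    ext y
    exact h1 y y.2

/-- Every (homogeneous) germ at `x` is the germ of a (homogeneous) section over `U ∋ x`. -/
theorem exists_germ_eq [T2Space M] (c : SuperChart F p q) (hx : x ∈ c.source)
    {U W : Opens M} (hWU : W ≤ U) (hxW : x ∈ W) {k : ZMod 2}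
    {s : F.obj W} (hs : s ∈ par k) :
    ∃ t ∈ (par k : Submodule ℝ (F.obj U)), germ F U (hWU hxW) t = germ F W hxW s := by
  obtain ⟨φ, Z, hZ, hφ, hcover, hφZ, hφ1⟩ := c.exists_bump hx hWU hxW
  -- The section `φ s` on `W` extends by zero, and its germ at `x` is that of `s` since `φ` has germ
  -- `1`.
  obtain ⟨t, htW, -⟩ := F.exists_glue₂ hWU hZ hcover (F.res hWU φ * s) 0 (by
    rw [map_zero, map_mul, F.res_res, ← F.res_res hZ inf_le_right, hφZ, map_zero, zero_mul])
  refine ⟨DirectSum.decompose par t k, SetLike.coe_mem _, ?_⟩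
  have hmem : F.res hWU φ * s ∈ (par k : Submodule ℝ (F.obj W)) := by
    simpa using SetLike.mul_mem_graded ((F.res hWU).map_par 0 _ hφ) hs
  rw [← germ_res F hWU hxW, SuperHom.map_decompose, htW,
    DirectSum.decompose_of_mem_same _ hmem, map_mul, germ_res, hφ1, one_mul]

/-- Cutting off with a bump section extends homogeneous sections; the general case follows by
splitting into components. -/
theorem germ_surjective [T2Space M] (c : SuperChart F p q) (hx : x ∈ c.source)
    (U : Opens M) (hxU : x ∈ U) :
    Function.Surjective (germ F U hxU) := by
  intro g
  obtain ⟨W, hxW, s, rfl⟩ := exists_germ F g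
  have hx' : x ∈ W ⊓ U := ⟨hxW, hxU⟩
  rw [← germ_res F (inf_le_left : W ⊓ U ≤ W) hx']
  generalize F.res _ s = s
  induction s using DirectSum.Decomposition.inductionOn
    (par : ZMod 2 → Submodule ℝ (F.obj (W ⊓ U))) with
  | zero => exact ⟨0, by rw [map_zero, map_zero]⟩
  | homogeneous m =>
    obtain ⟨t, -, ht⟩ := c.exists_germ_eq hx (inf_le_right : W ⊓ U ≤ U) hx' m.2
    exact ⟨t, ht⟩
  | add m m' h h' =>
    obtain ⟨t, ht⟩ := h
    obtain ⟨t', ht'⟩ := h'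
    exact ⟨t + t', by rw [map_add, map_add, ht, ht']⟩

end SuperChart

/-! ### The real numbers as a Weil algebra, and parity components of derivations -/

/-- This makes `T_x(M)` the case `A = ℝ` of derivations along an `A`-point, so that one basis
theorem covers both sides of the comparison. The nilpotent ideal is zero. -/
instance : SuperWeilAlgebra ℝ where
  nontrivial := inferInstance
  finite := inferInstance
  exists_nil := by
    refine ⟨⊥, inferInstance, Ideal.IsHomogeneous.bot _, ⟨1, ?_⟩, ?_⟩
    · rw [pow_one]; rfl
    · have h : (1 : Submodule ℝ ℝ) = ⊤ :=
        eq_top_iff.2 fun r _ => Submodule.mem_one.2 ⟨r, rfl⟩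
      rw [h]
      exact isCompl_top_bot

/-- Used to separate the even and the odd part of a derivation by their values on a homogeneous
element. -/
theorem eq_zero_of_add_eq_zero {A : Type*} [Ring A] [Algebra ℝ A] [Parity A] [CommSuperalgebra A]
    {i j : ZMod 2} (hij : i ≠ j) {a b : A} (ha : a ∈ par i) (hb : b ∈ par j) (h : a + b = 0) :
    a = 0 ∧ b = 0 := by
  have hba : b = -a := eq_neg_of_add_eq_zero_right h
  have ha0 : a = 0 := by
    rw [← DirectSum.decompose_of_mem_same (par : ZMod 2 → Submodule ℝ A) ha]
    refine DirectSum.decompose_of_mem_ne _ (i := j) ?_ hij.symm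
    rw [← neg_neg a, ← hba]
    exact Submodule.neg_mem _ hb
  exact ⟨ha0, by rw [hba, ha0, neg_zero]⟩

theorem homogDer_le_superDer {B A : Type*} [Ring B] [Algebra ℝ B] [Parity B] [Ring A]
    [Algebra ℝ A] [Parity A] [CommSuperalgebra A] {φ : SuperHom B A} {k : ZMod 2}
    {X : B →ₗ[ℝ] A} (hX : X ∈ homogDer φ k) : X ∈ superDer φ := by
  rcases parity_cases k with rfl | rfl
  · exact Submodule.mem_sup_left hX
  · exact Submodule.mem_sup_right hX

/-- Composition with a morphism, as a map of modules of derivations. -/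
def superDerPrecomp {B A C : Type*} [Ring B] [Algebra ℝ B] [Parity B] [Ring A] [Algebra ℝ A]
    [Parity A] [Ring C] [Algebra ℝ C] [Parity C] [CommSuperalgebra C] (φ : SuperHom A C)
    (ψ : SuperHom B A) : superDer φ →ₗ[C] superDer (φ.comp ψ) where
  toFun X := ⟨X.1 ∘ₗ ψ.toAlgHom.toLinearMap, by
    obtain ⟨X₀, h₀, X₁, h₁, h⟩ := Submodule.mem_sup.1 X.2
    rw [← h, LinearMap.add_comp]
    exact Submodule.add_mem_sup (homogDer_precomp h₀ ψ) (homogDer_precomp h₁ ψ)⟩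
  map_add' _ _ := rfl
  map_smul' _ _ := rfl

/-! ### Linearity of the action of germs of vector fields -/

section VectorFieldGerms

variable {M : Type u} [TopologicalSpace M] {F : SuperSheaf.{u, v} M} {x : M}

theorem act_real_smul (r : ℝ) (ξ : VFGerm F x) : act F (r • ξ) = r • act F ξ := by
  ext g
  obtain ⟨U, hU, D, s, -, rfl, rfl, -⟩ := exists_vfGerm_germ₂ F ξ g g
  rw [LinearMap.smul_apply, ← map_smul, act_germ, act_germ, ← map_smul]
  rfl

theorem act_smul (r : Stalk F x) (ξ : VFGerm F x) (g : Stalk F x) :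
    act F (r • ξ) g = r * act F ξ g := by
  obtain ⟨U, hU, D, s, t, rfl, rfl, rfl⟩ := exists_vfGerm_germ₂ F ξ r g
  rw [germ_smul_vfGerm, act_germ, act_germ, ← map_mul, VectorField.smul_apply, F.res_self]

/-- Composition of an algebra morphism with germs of vector fields. -/
def derOfVFGerm {A : Type*} [Ring A] [Algebra ℝ A] [Parity A] [CommSuperalgebra A]
    (φ : SuperHom (Stalk F x) A) : VFGerm F x →ₗ[ℝ] superDer φ where
  toFun ξ := ⟨φ.toAlgHom.toLinearMap ∘ₗ act F ξ, comp_act_mem F φ ξ⟩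
  map_add' ξ η := Subtype.ext (by
    simp only [act_add, LinearMap.comp_add]
    rfl)
  map_smul' r ξ := Subtype.ext (by
    simp only [act_real_smul, LinearMap.comp_smul]
    rfl)

theorem derOfVFGerm_apply {A : Type*} [Ring A] [Algebra ℝ A] [Parity A] [CommSuperalgebra A]
    (φ : SuperHom (Stalk F x) A) (ξ : VFGerm F x) (g : Stalk F x) :
    (derOfVFGerm φ ξ).1 g = φ (act F ξ g) := rfl

end VectorFieldGerms

namespace SuperChart

variable {M : Type u} [TopologicalSpace M] {F : SuperSheaf.{u, v} M} {p q : ℕ}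
  (c : SuperChart F p q) {x : M} (hx : x ∈ c.source)

/-! ### Derivations of the sections and of the stalk -/

theorem exists_germ_eq_of_mem_par [T2Space M] (c : SuperChart F p q) (hx : x ∈ c.source)
    {U : Opens M} (hU : x ∈ U) {k : ZMod 2} {g : Stalk F x} (hg : g ∈ par k) :
    ∃ t ∈ (par k : Submodule ℝ (F.obj U)), germ F U hU t = g := by
  refine stalk_par_induction F
    ((par k : Submodule ℝ (F.obj U)).map (germ F U hU).toLinearMap) (fun W hW s hs => ?_) hg
  have hx' : x ∈ W ⊓ U := ⟨hW, hU⟩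
  obtain ⟨t, ht, e⟩ := c.exists_germ_eq hx (inf_le_right : W ⊓ U ≤ U) hx'
    ((F.res (inf_le_left : W ⊓ U ≤ W)).map_par k s hs)
  exact ⟨t, ht, e.trans (germ_res F _ _ s)⟩

/-- Derivations along a point near `x` are local. -/
theorem apply_eq_zero_of_germ_eq_zero [T2Space M] (c : SuperChart F p q) (hx : x ∈ c.source)
    {A : Type*} [Ring A] [Algebra ℝ A] [Parity A] {φ : SuperHom (Stalk F x) A} {U : Opens M}
    (hU : x ∈ U) {k : ZMod 2} {X : F.obj U →ₗ[ℝ] A}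
    (hX : X ∈ homogDer (φ.comp (germHom F U hU)) k) {s : F.obj U} (hs : germ F U hU s = 0) :
    X s = 0 := by
  obtain ⟨W, hxW, hWU, _, e⟩ := (germ_eq_iff F hU hU s 0).1 (hs.trans (map_zero _).symm)
  -- `s` vanishes on `W` and `b` on `Z`, so `b s = 0`. In the Leibniz rule for `b s` the term with
  -- `X b` carries the factor `φ(s) = 0`, and `φ(b) = 1` leaves `X s`.
  obtain ⟨b, Z, hZ, hb, hcover, hbZ, hb1⟩ := c.exists_bump hx hWU hxW
  have hbs : b * s = 0 := by
    refine F.eq_of_eq₂ hWU hZ hcover ?_ ?_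
    · rw [map_mul, e, map_zero, mul_zero]
    · rw [map_mul, hbZ, zero_mul, map_zero]
  have h : X (b * s) = X b * φ (germ F U hU s) + sgn k 0 • (φ (germ F U hU b) * X s) :=
    hX.2 0 b hb s
  rw [hbs, map_zero, hs, map_zero, mul_zero, zero_add, sgn_zero_right, one_smul, hb1, map_one,
    one_mul] at h
  exact h.symm

/-- Derivations of `F(U)` along a point near `x ∈ U` factor through the stalk. -/
theorem exists_homogDer_comp_germ [T2Space M] (c : SuperChart F p q) (hx : x ∈ c.source)
    {A : Type*} [Ring A] [Algebra ℝ A] [Parity A] {φ : SuperHom (Stalk F x) A} {U : Opens M}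
    (hU : x ∈ U) {k : ZMod 2} {X : F.obj U →ₗ[ℝ] A}
    (hX : X ∈ homogDer (φ.comp (germHom F U hU)) k) :
    ∃ Y ∈ homogDer φ k, Y ∘ₗ (germ F U hU).toLinearMap = X := by
  -- Any linear choice of representatives works, because `X` kills sections with germ zero.
  obtain ⟨σ, hσ⟩ := (germ F U hU).toLinearMap.exists_rightInverse_of_surjective
    (LinearMap.range_eq_top.2 (c.germ_surjective hx U hU))
  have hσ' : ∀ g, germ F U hU (σ g) = g := fun g => LinearMap.congr_fun hσ g
  have hY : ∀ s, X (σ (germ F U hU s)) = X s := fun s => by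
    rw [← sub_eq_zero, ← map_sub]
    exact c.apply_eq_zero_of_germ_eq_zero hx hU hX (by rw [map_sub, hσ', sub_self])
  refine ⟨X ∘ₗ σ, ⟨fun j g hg => ?_, fun j g hg h => ?_⟩, LinearMap.ext hY⟩
  -- `σ` need not respect parity, so a homogeneous representative is taken instead; `X` does not see
  -- the difference.
  · obtain ⟨t, ht, rfl⟩ := c.exists_germ_eq_of_mem_par hx hU hg
    show X (σ _) ∈ _
    rw [hY]
    exact hX.1 j t ht
  · obtain ⟨s, hs, rfl⟩ := c.exists_germ_eq_of_mem_par hx hU hg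
    obtain ⟨t, rfl⟩ := c.germ_surjective hx U hU h
    show X (σ _) = X (σ _) * _ + sgn k j • (_ * X (σ _))
    rw [← map_mul, hY, hY, hY]
    exact hX.2 j s hs t

/-- Injectivity holds because every germ is represented over `U`, surjectivity because the even and
the odd part of a derivation each factor through the stalk. All neighbourhoods `U` are thereby
treated at once. -/
theorem superDerPrecomp_germ_bijective [T2Space M] (c : SuperChart F p q) (hx : x ∈ c.source)
    {A : Type*} [Ring A] [Algebra ℝ A] [Parity A] [CommSuperalgebra A]
    (φ : SuperHom (Stalk F x) A) (U : Opens M) (hU : x ∈ U) :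
    Function.Bijective (superDerPrecomp φ (germHom F U hU)) := by
  refine ⟨fun X Y h => Subtype.ext (LinearMap.ext fun g => ?_), fun X => ?_⟩
  · obtain ⟨s, rfl⟩ := c.germ_surjective hx U hU g
    exact LinearMap.congr_fun (congrArg Subtype.val h) s
  · obtain ⟨X₀, h₀, X₁, h₁, h⟩ := Submodule.mem_sup.1 X.2
    obtain ⟨Y₀, hY₀, rfl⟩ := c.exists_homogDer_comp_germ hx hU h₀
    obtain ⟨Y₁, hY₁, rfl⟩ := c.exists_homogDer_comp_germ hx hU h₁
    exact ⟨⟨Y₀ + Y₁, Submodule.add_mem_sup hY₀ hY₁⟩, Subtype.ext h⟩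

/-- The derivations of the stalk and of `F(U)` along a point near `x ∈ U` agree. -/
def derEquiv [T2Space M] {A : Type*} [Ring A] [Algebra ℝ A] [Parity A] [CommSuperalgebra A]
    (φ : SuperHom (Stalk F x) A) (U : Opens M) (hU : x ∈ U) :
    superDer φ ≃ₗ[A] superDer (φ.comp (germHom F U hU)) :=
  LinearEquiv.ofBijective _ (c.superDerPrecomp_germ_bijective hx φ U hU)

/-! ### The coordinates of a derivation of the stalk -/

/-- An `A`-point near `x` maps the coordinates, centred at `x`, into the nilpotent ideal. -/
theorem exists_nilpotent_coord {A : Type*} [Ring A] [Algebra ℝ A] [Parity A]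
    [CommSuperalgebra A] [SuperWeilAlgebra A] (φ : SuperHom (Stalk F x) A) :
    ∃ (N : Submodule ℝ A) (n : ℕ), N ^ n = ⊥ ∧ ∀ i, φ (c.toStalk hx (evenCoord q ⊤ i)) -
      algebraMap ℝ A (c.homeo x i) ∈ N := by
  obtain ⟨N, -, -, ⟨n, hn⟩, hN⟩ := SuperWeilAlgebra.exists_nil (A := A)
  have := SuperWeilAlgebra.nontrivial (A := A)
  refine ⟨N.restrictScalars ℝ, n, hn, fun i => ?_⟩
  set a := φ (c.toStalk hx (evenCoord q ⊤ i)) - algebraMap ℝ A (c.homeo x i) with ha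
  obtain ⟨_, h1, m, hm, e⟩ := Submodule.mem_sup.1 (hN.sup_eq_top.ge (Submodule.mem_top (x := a)))
  obtain ⟨r, rfl⟩ := Submodule.mem_one.1 h1
  by_cases hr : r = 0
  · rw [hr, map_zero, zero_add] at e
    rwa [← e]
  exfalso
  -- If the scalar part `r` of the image `a = r + m` were nonzero, this function would not vanish at
  -- the point, so its germ would be a unit. Its image is the nilpotent `m`, which is impossible in
  -- a nontrivial ring.
  let f : SmoothFun p ⊤ := smoothCoord ⊤ i - algebraMap ℝ _ (c.homeo x i + r)
  have hf : f ⟨c.homeo x, trivial⟩ ≠ 0 := by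
    have : f ⟨c.homeo x, trivial⟩ = c.homeo x i - (c.homeo x i + r) := rfl
    rw [this]
    simpa using hr
  have hfm : φ (c.toStalk hx (f ⊗ₜ 1)) = m := by
    have : f ⊗ₜ[ℝ] (1 : Grassmann q) =
        evenCoord q ⊤ i - algebraMap ℝ (SuperFun p q ⊤) (c.homeo x i + r) := by
      rw [TensorProduct.sub_tmul]; rfl
    rw [this, map_sub, map_sub, AlgHom.commutes, AlgHom.commutes, map_add, ← sub_sub, ← ha, ← e,
      add_sub_cancel_left]
  have hu : IsUnit m := hfm ▸ (c.isUnit_toStalk hx hf).map φ.toAlgHom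
  have hnil : m ^ n = 0 := by
    have := Submodule.pow_mem_pow (N.restrictScalars ℝ) hm n
    rwa [hn, Submodule.mem_bot] at this
  exact not_isUnit_zero (hnil ▸ hu.pow n)

/-- Superfunctions on `ℝ^{p|q}` surject onto the stalk, so the vanishing criterion of the global
model carries over. -/
theorem homogDer_stalk_eq_zero {A : Type*} [Ring A] [Algebra ℝ A] [Parity A]
    [CommSuperalgebra A] [SuperWeilAlgebra A] {φ : SuperHom (Stalk F x) A} {k : ZMod 2}
    {X : Stalk F x →ₗ[ℝ] A} (hX : X ∈ homogDer φ k)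
    (h₀ : ∀ i, X (c.toStalk hx (evenCoord q ⊤ i)) = 0)
    (h₁ : ∀ j, X (c.toStalk hx (oddCoord ⊤ j)) = 0) : X = 0 := by
  obtain ⟨N, n, hN, hu⟩ := c.exists_nilpotent_coord hx φ
  have h := homogDer_eq_zero_of_coord (φ.comp (c.toStalk hx)) hN (c.homeo x) hu
    (homogDer_precomp hX (c.toStalk hx)) h₀ h₁
  ext g
  obtain ⟨s, rfl⟩ := c.toStalk_surjective hx g
  exact LinearMap.congr_fun h s

variable {A : Type w} [Ring A] [Algebra ℝ A] [Parity A] [CommSuperalgebra A]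
  (φ : SuperHom (Stalk F x) A)

/-- The coordinate vector fields as germs at `x`. -/
def coordGerm : Fin p ⊕ Fin q → VFGerm F x :=
  Sum.elim (fun i => vfGerm F c.source hx (c.dx i)) (fun j => vfGerm F c.source hx (c.dθ j))

/-- The values of a derivation on the coordinates. -/
def coordValue : superDer φ →ₗ[A] (Fin p ⊕ Fin q → A) where
  toFun X := Sum.elim (fun i => X.1 (c.toStalk hx (evenCoord q ⊤ i)))
    (fun j => X.1 (c.toStalk hx (oddCoord ⊤ j)))
  map_add' X Y := by ext (i | j) <;> rfl
  map_smul' a X := by ext (i | j) <;> rfl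

theorem coordValue_inl (X : superDer φ) (i : Fin p) :
    c.coordValue hx φ X (.inl i) = X.1 (c.toStalk hx (evenCoord q ⊤ i)) := rfl

theorem coordValue_inr (X : superDer φ) (j : Fin q) :
    c.coordValue hx φ X (.inr j) = X.1 (c.toStalk hx (oddCoord ⊤ j)) := rfl

/-- Coordinates and coordinate fields are dual to each other; this both solves for prescribed values
and identifies the resulting basis. -/
theorem coordValue_coordGerm (a : Fin p ⊕ Fin q) :
    c.coordValue hx φ (derOfVFGerm φ (c.coordGerm hx a)) = Pi.single a 1 := by
  ext b
  rcases a with i | j <;> rcases b with l | l <;>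
    simp only [coordValue_inl, coordValue_inr, derOfVFGerm_apply, coordGerm, Sum.elim_inl,
      Sum.elim_inr, act_dx_toStalk, act_dθ_toStalk, modelDx_evenCoord, modelDx_oddCoord,
      modelDθ_evenCoord, modelDθ_oddCoord, Pi.single_apply, map_zero, Sum.inl.injEq,
      Sum.inr.injEq, reduceCtorEq, if_false]
  · split_ifs <;> simp
  · split_ifs <;> simp

/-- The vanishing criterion concerns homogeneous derivations. On a given coordinate the even and the
odd part take values of opposite parity, so if their sum vanishes there, both do. Surjectivity comes
from duality. -/
theorem coordValue_bijective [SuperWeilAlgebra A] :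
    Function.Bijective (c.coordValue hx φ) := by
  constructor
  · refine (injective_iff_map_eq_zero _).2 fun X hX => ?_
    obtain ⟨X₀, h₀, X₁, h₁, h⟩ := Submodule.mem_sup.1 X.2
    have hi : ∀ i, X₀ (c.toStalk hx (evenCoord q ⊤ i)) = 0 ∧
        X₁ (c.toStalk hx (evenCoord q ⊤ i)) = 0 := fun i => by
      have hp := (c.toStalk hx).map_par 0 _ (evenCoord_mem (q := q) i)
      refine eq_zero_of_add_eq_zero (by decide) (h₀.1 0 _ hp) (h₁.1 0 _ hp) ?_
      rw [← LinearMap.add_apply, h]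
      exact congrFun hX (.inl i)
    have hj : ∀ j, X₀ (c.toStalk hx (oddCoord ⊤ j)) = 0 ∧
        X₁ (c.toStalk hx (oddCoord ⊤ j)) = 0 := fun j => by
      have hp := (c.toStalk hx).map_par 1 _ (oddCoord_mem j)
      refine eq_zero_of_add_eq_zero (by decide) (h₀.1 1 _ hp) (h₁.1 1 _ hp) ?_
      rw [← LinearMap.add_apply, h]
      exact congrFun hX (.inr j)
    refine Subtype.ext ?_
    rw [← h, c.homogDer_stalk_eq_zero hx h₀ (fun i => (hi i).1) (fun j => (hj j).1),
      c.homogDer_stalk_eq_zero hx h₁ (fun i => (hi i).2) (fun j => (hj j).2), add_zero]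
    rfl
  · intro f
    refine ⟨∑ a, f a • derOfVFGerm φ (c.coordGerm hx a), ?_⟩
    simp only [map_sum, map_smul, coordValue_coordGerm]
    exact (pi_eq_sum_univ' f).symm

/-- The derivations of the stalk along `φ` form a free `A`-module with basis the compositions of
`φ` with the coordinate vector fields. -/
def derBasis [SuperWeilAlgebra A] : Module.Basis (Fin p ⊕ Fin q) A (superDer φ) :=
  Module.Basis.ofEquivFun (LinearEquiv.ofBijective _ (c.coordValue_bijective hx φ))

theorem derBasis_apply [SuperWeilAlgebra A] (a : Fin p ⊕ Fin q) :
    c.derBasis hx φ a = derOfVFGerm φ (c.coordGerm hx a) := by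
  apply (c.coordValue_bijective hx φ).1
  rw [coordValue_coordGerm, derBasis, Module.Basis.coe_ofEquivFun]
  exact (LinearEquiv.ofBijective _ (c.coordValue_bijective hx φ)).apply_symm_apply _

theorem coordGerm_homog_inl (i : Fin p) :
    (derOfVFGerm φ (c.coordGerm hx (.inl i))).1 ∈ homogDer φ 0 :=
  homogDer_postcomp (act_homog F hx (c.dx i) ⟨fun W => c.pull_mem W.1 W.2 (modelDx_mem q i),
    fun W _ h s => c.res_pull W.2 h (fun h' s => modelRes_modelDx q i h' s) s⟩) φ

theorem coordGerm_homog_inr (j : Fin q) :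
    (derOfVFGerm φ (c.coordGerm hx (.inr j))).1 ∈ homogDer φ 1 :=
  homogDer_postcomp (act_homog F hx (c.dθ j) ⟨fun W => c.pull_mem W.1 W.2 (modelDθ_mem j),
    fun W _ h s => c.res_pull W.2 h (fun h' s => modelRes_modelDθ j h' s) s⟩) φ

end SuperChart

/-! ### The tensor product along an `A`-point -/

section RhoTensor

/-- The map `A ⊗_ρ L → P` defined by a `ρ`-semilinear map `L → P`. -/
def rhoLift {B A L P : Type*} [Ring B] [Algebra ℝ B] [Ring A] [Algebra ℝ A] (ρ : B →ₐ[ℝ] A)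
    [AddCommGroup L] [Module ℝ L] [Module B L] [AddCommGroup P] [Module ℝ P] [Module A P]
    [IsScalarTower ℝ A P] (g : L →ₗ[ℝ] P) (hg : ∀ b l, g (b • l) = ρ b • g l) :
    RhoTensor ρ L →ₗ[A] P :=
  (rhoRel ρ L).liftQ
    (TensorProduct.AlgebraTensorModule.lift (LinearMap.toSpanSingleton A (L →ₗ[ℝ] P) g)) <| by
    refine Submodule.span_le.2 ?_
    rintro _ ⟨a, b, l, rfl⟩
    refine LinearMap.mem_ker.2 ?_
    rw [map_sub, sub_eq_zero]
    show a • g (b • l) = (a * ρ b) • g l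
    rw [hg, mul_smul]

variable {M : Type u} [TopologicalSpace M] {F : SuperSheaf.{u, v} M} {x : M}
  {A : Type w} [Ring A] [Algebra ℝ A] [Parity A] [CommSuperalgebra A]
  (φ : SuperHom (Stalk F x) A)

/-- This semilinearity is what lets `a ⊗ ξ ↦ a (φ ∘ ξ)` descend to the quotient. -/
theorem derOfVFGerm_smul (b : Stalk F x) (ξ : VFGerm F x) :
    derOfVFGerm φ (b • ξ) = φ b • derOfVFGerm φ ξ := by
  refine Subtype.ext (LinearMap.ext fun g => ?_)
  show φ (act F (b • ξ) g) = φ b * φ (act F ξ g)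
  rw [act_smul, map_mul]

/-- The map `A ⊗_φ 𝒯_x → Der_φ`, `a ⊗ ξ ↦ a (φ ∘ ξ)`. -/
def rhoToDer : RhoTensor φ.toAlgHom (VFGerm F x) →ₗ[A] superDer φ :=
  rhoLift (P := superDer φ) φ.toAlgHom (derOfVFGerm φ) (derOfVFGerm_smul φ)

theorem rhoToDer_mk (a : A) (ξ : VFGerm F x) :
    rhoToDer φ (Submodule.Quotient.mk (a ⊗ₜ[ℝ] ξ)) = a • derOfVFGerm φ ξ := rfl

end RhoTensor

namespace SuperChart

variable {M : Type u} [TopologicalSpace M] {F : SuperSheaf.{u, v} M} {p q : ℕ}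
  (c : SuperChart F p q) {x : M} (hx : x ∈ c.source)

/-! ### Germs of vector fields are combinations of the coordinate vector fields -/

theorem pull_pullback (W : Opens M) (hW : W ≤ c.source)
    (D : SuperFun p q (c.image W) →ₗ[ℝ] SuperFun p q (c.image W)) (s : SuperFun p q ⊤) :
    c.pull W hW D (c.pullback W hW s) = (c.iso W hW).symm (D (modelRes q le_top s)) := by
  show (c.iso W hW).symm (D (c.iso W hW ((c.iso W hW).symm _))) = _
  rw [AlgEquiv.apply_symm_apply]
  rfl

theorem dx_pullback (W : Opens M) (hW : W ≤ c.source) (i : Fin p) (s : SuperFun p q ⊤) :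
    (c.dx i).1 ⟨W, hW⟩ (c.pullback W hW s) = c.pullback W hW (modelDx q i s) :=
  (c.pull_pullback W hW _ s).trans (by rw [← modelRes_modelDx]; rfl)

theorem dθ_pullback (W : Opens M) (hW : W ≤ c.source) (j : Fin q) (s : SuperFun p q ⊤) :
    (c.dθ j).1 ⟨W, hW⟩ (c.pullback W hW s) = c.pullback W hW (modelDθ j s) :=
  (c.pull_pullback W hW _ s).trans (by rw [← modelRes_modelDθ]; rfl)

/-- The isomorphism of a chart as a morphism of superalgebras. -/
def isoHom (W : Opens M) (hW : W ≤ c.source) : SuperHom (F.obj W) (SuperFun p q (c.image W)) :=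
  ⟨(c.iso W hW : F.obj W →ₐ[ℝ] _), fun k s hs => (c.iso_par W hW k s).2 hs⟩

/-- A derivation of `F(W)` that vanishes on the coordinates vanishes on the restrictions of
superfunctions on `ℝ^{p|q}`. -/
theorem homogDer_pullback_eq_zero (W : Opens M) (hW : W ≤ c.source) {k : ZMod 2}
    {D : F.obj W →ₗ[ℝ] F.obj W} (hD : D ∈ homogDer (SuperHom.id (F.obj W)) k)
    (h₀ : ∀ i, D (c.pullback W hW (evenCoord q ⊤ i)) = 0)
    (h₁ : ∀ j, D (c.pullback W hW (oddCoord ⊤ j)) = 0) (s : SuperFun p q ⊤) :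
    D (c.pullback W hW s) = 0 := by
  apply (c.iso W hW).injective
  rw [map_zero]
  refine superFun_eq_zero fun u => ?_
  -- Evaluation of coefficients at `u` sends the even coordinates exactly to the scalars `u_i`. The
  -- vanishing criterion therefore applies with `N = 0`, for each `u` separately.
  let ε : SuperHom (F.obj W) (Grassmann q) := (modelEvalGrassmann q u).comp (c.isoHom W hW)
  have hε : ∀ t, ε (c.pullback W hW t) = modelEvalGrassmann q u (modelRes q le_top t) :=
    fun t => congrArg (modelEvalGrassmann q u) ((c.iso W hW).apply_symm_apply _)
  have h := homogDer_eq_zero_of_coord (N := ⊥) (n := 1)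
    ((ε.comp (SuperHom.id _)).comp (c.pullback W hW)) (pow_one _) u.1 (fun i => ?_)
    (homogDer_precomp (homogDer_postcomp hD ε) (c.pullback W hW)) (fun i => ?_) (fun j => ?_)
  · exact LinearMap.congr_fun h s
  · rw [Submodule.mem_bot, sub_eq_zero]
    refine (hε _).trans ((modelEvalGrassmann_tmul u _ _).trans ?_)
    rw [Algebra.algebraMap_eq_smul_one]
    rfl
  · show ε (D (c.pullback W hW (evenCoord q ⊤ i))) = 0
    rw [h₀, map_zero]
  · show ε (D (c.pullback W hW (oddCoord ⊤ j))) = 0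
    rw [h₁, map_zero]

/-- Near each point every section is the pullback of a superfunction on `ℝ^{p|q}`, on which `D`
vanishes by the previous lemma. Since `D` commutes with restriction, all germs of `D s` are zero. -/
theorem vectorField_eq_zero {W : Opens M} (hW : W ≤ c.source) {k : ZMod 2}
    (D : VectorField F W) (hD : ∀ W', D.1 W' ∈ homogDer (SuperHom.id (F.obj W'.1)) k)
    (h₀ : ∀ i, D.1 ⟨W, le_rfl⟩ (c.pullback W hW (evenCoord q ⊤ i)) = 0)
    (h₁ : ∀ j, D.1 ⟨W, le_rfl⟩ (c.pullback W hW (oddCoord ⊤ j)) = 0) : D = 0 := by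
  have key : ∀ (W' : Opens M) (h : W' ≤ W) (s : SuperFun p q ⊤),
      D.1 ⟨W', h⟩ (c.pullback W' (h.trans hW) s) = 0 := fun W' h => by
    refine c.homogDer_pullback_eq_zero W' _ (hD ⟨W', h⟩) (fun i => ?_) (fun j => ?_)
    · rw [← c.res_pullback hW h, ← VectorField.res_apply D le_rfl h, h₀, map_zero]
    · rw [← c.res_pullback hW h, ← VectorField.res_apply D le_rfl h, h₁, map_zero]
  refine Subtype.ext (funext fun ⟨W', h⟩ => LinearMap.ext fun s => ?_)
  refine eq_zero_of_germ_eq_zero F _ fun y hy => ?_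
  obtain ⟨t, ht⟩ := c.toStalk_surjective (hW (h hy)) (germ F W' hy s)
  rw [← c.germ_pullback (hW (h hy)) (h.trans hW) hy] at ht
  obtain ⟨W'', hy'', hle, _, e⟩ := (germ_eq_iff F hy hy _ _).1 ht
  rw [← germ_res F hle hy'', VectorField.res_apply D h hle, ← e, c.res_pullback, key, map_zero]

/-- The germs of vector fields are combinations of the coordinate vector fields. -/
theorem exists_vfGerm_eq_sum (ξ : VFGerm F x) :
    ∃ r : Fin p ⊕ Fin q → Stalk F x, ξ = ∑ a, r a • c.coordGerm hx a := by
  have key : ∀ (W : Opens M) (hxW : x ∈ W) (hW : W ≤ c.source) (k : ZMod 2)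
      (D : VectorField F W), D.1 ∈ homogVectorField F W k →
      ∃ r : Fin p ⊕ Fin q → Stalk F x, vfGerm F W hxW D = ∑ a, r a • c.coordGerm hx a := by
    intro W hxW hW k D hD
    -- The coefficients are forced: by duality they must be the values of `D` on the coordinates.
    let r₀ : Fin p → F.obj W := fun i => D.1 ⟨W, le_rfl⟩ (c.pullback W hW (evenCoord q ⊤ i))
    let r₁ : Fin q → F.obj W := fun j => D.1 ⟨W, le_rfl⟩ (c.pullback W hW (oddCoord ⊤ j))
    have hr₀ : ∀ i, r₀ i ∈ par (0 + k) := fun i =>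
      (hD.1 ⟨W, le_rfl⟩).1 0 _ ((c.pullback W hW).map_par 0 _ (evenCoord_mem i))
    have hr₁ : ∀ j, r₁ j ∈ par (1 + k) := fun j =>
      (hD.1 ⟨W, le_rfl⟩).1 1 _ ((c.pullback W hW).map_par 1 _ (oddCoord_mem j))
    let E : VectorField F W := ∑ i, r₀ i • VectorField.restrict hW (c.dx i) +
      ∑ j, r₁ j • VectorField.restrict hW (c.dθ j)
    have hE : ∀ W' : {W' : Opens M // W' ≤ W}, E.1 W' =
        ∑ i, F.res W'.2 (r₀ i) • (c.dx i).1 ⟨W'.1, W'.2.trans hW⟩ +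
          ∑ j, F.res W'.2 (r₁ j) • (c.dθ j).1 ⟨W'.1, W'.2.trans hW⟩ := fun W' => by
      simp only [E, Submodule.coe_add, AddSubmonoidClass.coe_finsetSum, Pi.add_apply,
        Finset.sum_apply]
      rfl
    have hE' : ∀ s : SuperFun p q ⊤, E.1 ⟨W, le_rfl⟩ (c.pullback W hW s) =
        ∑ i, r₀ i * c.pullback W hW (modelDx q i s) +
          ∑ j, r₁ j * c.pullback W hW (modelDθ j s) := fun s => by
      rw [hE]
      simp only [LinearMap.add_apply, LinearMap.sum_apply, LinearMap.smul_apply]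
      congr 1
      · refine Finset.sum_congr rfl fun i _ => ?_
        rw [F.res_self, smul_eq_mul, ← c.dx_pullback W hW]
      · refine Finset.sum_congr rfl fun j _ => ?_
        rw [F.res_self, smul_eq_mul, ← c.dθ_pullback W hW]
    have hDE : D = E := by
      refine sub_eq_zero.1 (c.vectorField_eq_zero hW (k := k) _ (fun W' => ?_) (fun l => ?_)
        (fun l => ?_))
      -- The difference is homogeneous of parity `k`: a coefficient of `∂/∂x_i` has parity `k`, one
      -- of `∂/∂θ_j` has parity `1 + k`, and the parity of `∂/∂θ_j` cancels the `1`.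
      · refine Submodule.sub_mem _ (hD.1 W') ?_
        rw [hE]
        refine Submodule.add_mem _ (Submodule.sum_mem _ fun i _ => ?_)
          (Submodule.sum_mem _ fun j _ => ?_)
        · have := smul_homogDer (SuperHom.id (F.obj W'.1)) ((F.res W'.2).map_par _ _ (hr₀ i))
            (c.pull_mem W'.1 (W'.2.trans hW) (modelDx_mem q i))
          rwa [zero_add, zero_add] at this
        · have := smul_homogDer (SuperHom.id (F.obj W'.1)) ((F.res W'.2).map_par _ _ (hr₁ j))
            (c.pull_mem W'.1 (W'.2.trans hW) (modelDθ_mem j))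
          rwa [← add_assoc, show (1 : ZMod 2) + 1 = 0 from rfl, zero_add] at this
      · show D.1 _ _ - E.1 _ _ = 0
        rw [hE', sub_eq_zero]
        simp only [modelDx_evenCoord, modelDθ_evenCoord, map_zero, mul_zero,
          Finset.sum_const_zero, add_zero]
        rw [Finset.sum_eq_single l (fun i _ hi => by rw [if_neg hi.symm, map_zero, mul_zero])
          (fun h => absurd (Finset.mem_univ l) h), if_pos rfl, map_one, mul_one]
      · show D.1 _ _ - E.1 _ _ = 0
        rw [hE', sub_eq_zero]
        simp only [modelDx_oddCoord, modelDθ_oddCoord, map_zero, mul_zero,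
          Finset.sum_const_zero, zero_add]
        rw [Finset.sum_eq_single l (fun i _ hi => by rw [if_neg hi.symm, map_zero, mul_zero])
          (fun h => absurd (Finset.mem_univ l) h), if_pos rfl, map_one, mul_one]
    refine ⟨Sum.elim (fun i => germ F W hxW (r₀ i)) (fun j => germ F W hxW (r₁ j)), ?_⟩
    rw [hDE, Fintype.sum_sum_type, map_add, map_sum, map_sum]
    simp only [← germ_smul_vfGerm, vfGerm_restrict]
    rfl
  obtain ⟨U, hU, D, rfl⟩ := exists_vfGerm F ξ
  have hx' : x ∈ U ⊓ c.source := ⟨hU, hx⟩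
  rw [← vfGerm_restrict F inf_le_left hx']
  generalize VectorField.restrict _ D = D
  obtain ⟨D₀, h₀, D₁, h₁, h⟩ := Submodule.mem_sup.1 D.2
  obtain ⟨r, hr⟩ := key _ hx' inf_le_right 0 ⟨D₀, homog_le_vectorField _ 0 h₀⟩ h₀
  obtain ⟨r', hr'⟩ := key _ hx' inf_le_right 1 ⟨D₁, homog_le_vectorField _ 1 h₁⟩ h₁
  refine ⟨r + r', ?_⟩
  have e : D = ⟨D₀, homog_le_vectorField _ 0 h₀⟩ + ⟨D₁, homog_le_vectorField _ 1 h₁⟩ :=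
    Subtype.ext h.symm
  rw [e, map_add, hr, hr', ← Finset.sum_add_distrib]
  exact Finset.sum_congr rfl fun a _ => (add_smul _ _ _).symm

variable {A : Type w} [Ring A] [Algebra ℝ A] [Parity A] (φ : SuperHom (Stalk F x) A)

/-- A germ is a combination of coordinate fields over the stalk, and the defining relations move its
coefficients through `φ` into `A`. -/
theorem span_coordGerm_eq_top :
    Submodule.span A (Set.range fun a => (Submodule.Quotient.mk ((1 : A) ⊗ₜ[ℝ] c.coordGerm hx a) :
      RhoTensor φ.toAlgHom (VFGerm F x))) = ⊤ := by
  refine eq_top_iff.2 fun z _ => ?_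
  obtain ⟨z, rfl⟩ := Submodule.Quotient.mk_surjective _ z
  induction z using TensorProduct.induction_on with
  | zero => exact Submodule.zero_mem _
  | add y z hy hz => exact Submodule.add_mem _ (hy trivial) (hz trivial)
  | tmul a ξ =>
    obtain ⟨r, rfl⟩ := c.exists_vfGerm_eq_sum hx ξ
    rw [TensorProduct.tmul_sum, ← Submodule.mkQ_apply, map_sum]
    refine Submodule.sum_mem _ fun b _ => ?_
    have e : (rhoRel φ.toAlgHom (VFGerm F x)).mkQ (a ⊗ₜ[ℝ] (r b • c.coordGerm hx b)) =
        (a * φ (r b)) • Submodule.Quotient.mk ((1 : A) ⊗ₜ[ℝ] c.coordGerm hx b) := by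
      rw [← Submodule.Quotient.mk_smul, TensorProduct.smul_tmul', smul_eq_mul, mul_one]
      exact (Submodule.Quotient.eq _).2 (Submodule.subset_span ⟨a, r b, _, rfl⟩)
    rw [e]
    exact Submodule.smul_mem _ _ (Submodule.subset_span ⟨b, rfl⟩)

/-- A linear map that sends a spanning family to a basis, index by index, is bijective; independence
of the coordinate fields over the stalk is not needed. -/
theorem rhoToDer_bijective [CommSuperalgebra A] [SuperWeilAlgebra A] (c : SuperChart F p q) (hx : x ∈ c.source) :
    Function.Bijective (rhoToDer φ) := by
  let b := c.derBasis hx φ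
  let ψ : superDer φ →ₗ[A] RhoTensor φ.toAlgHom (VFGerm F x) :=
    -- The auxiliary scalars `ℕ` only serve to make `constr` available over the noncommutative ring
    -- `A`.
    b.constr ℕ fun a => Submodule.Quotient.mk ((1 : A) ⊗ₜ[ℝ] c.coordGerm hx a)
  have hb : ∀ a, rhoToDer φ (Submodule.Quotient.mk ((1 : A) ⊗ₜ[ℝ] c.coordGerm hx a)) = b a :=
    fun a => by rw [rhoToDer_mk, one_smul]; exact (c.derBasis_apply hx φ a).symm
  have h₁ : ψ ∘ₗ rhoToDer φ = LinearMap.id := by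
    refine LinearMap.ext_on_range (c.span_coordGerm_eq_top hx φ) fun a => ?_
    rw [LinearMap.comp_apply, hb]
    exact b.constr_basis ℕ _ a
  have h₂ : rhoToDer φ ∘ₗ ψ = LinearMap.id := b.ext fun a => by
    rw [LinearMap.comp_apply, b.constr_basis, hb]
    rfl
  exact ⟨Function.LeftInverse.injective (g := ψ) (LinearMap.congr_fun h₁),
    Function.RightInverse.surjective (g := ψ) (LinearMap.congr_fun h₂)⟩

end SuperChart

/-! ### Derivations along an `A`-point in a chart -/

namespace Supermanifold

variable {M : Type u} [TopologicalSpace M] [T2Space M] {p q : ℕ} {X : Supermanifold.{u, v} M p q}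
  {x : M} {A : Type w} [Ring A] [Algebra ℝ A] [Parity A] [CommSuperalgebra A]
  [SuperWeilAlgebra A] (xA : X.APoint x A) (c : SuperChart X.toSuperSheaf p q)
  (hc : x ∈ c.source) (U : Opens M) (hU : x ∈ U)

/-- The `x_A`-derivations of the stalk and of `𝒪(U)` agree. -/
def APoint.derEquiv : superDer xA ≃ₗ[A] xA.Der U hU := c.derEquiv hc xA U hU

/-- The basis `x_A ∘ ∂/∂x_i, x_A ∘ ∂/∂θ_j` of the `A`-module of `x_A`-derivations. -/
def APoint.derBasis : Module.Basis (Fin p ⊕ Fin q) A (xA.Der U hU) :=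
  (c.derBasis hc xA).map (xA.derEquiv c hc U hU)

theorem APoint.derBasis_coe (a : Fin p ⊕ Fin q) :
    (xA.derBasis c hc U hU a).1 = xA.compVF U hU (c.coordGerm hc a) := by
  rw [APoint.derBasis, Module.Basis.map_apply, SuperChart.derBasis_apply]
  rfl

theorem APoint.coordDer_eq (f : Fin p → A) (G : Fin q → A) :
    xA.coordDer c hc U hU f G =
      ((xA.derBasis c hc U hU).equivFun.symm (Sum.elim f G) : xA.Der U hU).1 := by
  rw [Module.Basis.equivFun_symm_apply, AddSubmonoidClass.coe_finsetSum, Fintype.sum_sum_type]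
  simp only [Submodule.coe_smul, APoint.derBasis_coe]
  rfl

/-- The coefficients are the values on the coordinates, of parity `0` and `1`, so a derivation of
parity `k` forces their parities. Conversely each summand has parity `k`, since `1 + 1 = 0`. -/
theorem APoint.coordDer_mem_homogDer_iff (f : Fin p → A) (G : Fin q → A) (k : ZMod 2) :
    xA.coordDer c hc U hU f G ∈ homogDer (xA.on U hU) k ↔
      (∀ i, f i ∈ par k) ∧ ∀ j, G j ∈ par (k + 1) := by
  have h11 : (1 : ZMod 2) + 1 = 0 := rfl
  constructor
  · intro h
    obtain ⟨Y, hY, e⟩ := c.exists_homogDer_comp_germ hc hU h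
    -- The expansion in coordinate fields is moved to the stalk, where the global model supplies the
    -- coordinates even if `U` is not contained in the chart.
    have hYe : (⟨Y, homogDer_le_superDer hY⟩ : superDer xA) =
        (c.derBasis hc xA).equivFun.symm (Sum.elim f G) := by
      apply (xA.derEquiv c hc U hU).injective
      refine Subtype.ext (e.trans ((xA.coordDer_eq c hc U hU f G).trans ?_))
      simp only [Module.Basis.equivFun_symm_apply, map_sum, map_smul, APoint.derBasis,
        Module.Basis.map_apply]
    have hv : c.coordValue hc xA ⟨Y, homogDer_le_superDer hY⟩ = Sum.elim f G := by
      rw [hYe]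
      exact (LinearEquiv.ofBijective _ (c.coordValue_bijective hc xA)).apply_symm_apply _
    refine ⟨fun i => ?_, fun j => ?_⟩
    · have := hY.1 0 _ ((c.toStalk hc).map_par 0 _ (evenCoord_mem i))
      rw [zero_add] at this
      rwa [show Y _ = f i from congrFun hv (.inl i)] at this
    · have := hY.1 1 _ ((c.toStalk hc).map_par 1 _ (oddCoord_mem j))
      rw [add_comm] at this
      rwa [show Y _ = G j from congrFun hv (.inr j)] at this
  · rintro ⟨hf, hG⟩
    refine Submodule.add_mem _ (Submodule.sum_mem _ fun i _ => ?_)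
      (Submodule.sum_mem _ fun j _ => ?_)
    · have := smul_homogDer (xA.on U hU) (hf i)
        (homogDer_precomp (c.coordGerm_homog_inl hc xA i) (germHom X.toSuperSheaf U hU))
      rwa [zero_add] at this
    · have := smul_homogDer (xA.on U hU) (hG j)
        (homogDer_precomp (c.coordGerm_homog_inr hc xA j) (germHom X.toSuperSheaf U hU))
      rwa [add_left_comm, h11, add_zero] at this

/-- The isomorphism `A ⊗ T_x(M) → Der_{x_A}(𝒪(U), A)` defined by a chart. -/
def APoint.tensorEquiv : (A ⊗[ℝ] X.TangentSuperspace x) ≃ₗ[A] xA.Der U hU :=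
  -- The basis theorem holds in any chart around `x` for any morphism into a Weil algebra, so it is
  -- harmless that `ev` was computed in a chart other than `c`.
  (Algebra.TensorProduct.basis A (c.derBasis hc (X.ev x))).equiv (xA.derBasis c hc U hU)
    (Equiv.refl _)

theorem APoint.tensorEquiv_tmul (a : A) (b : Fin p ⊕ Fin q) :
    (xA.tensorEquiv c hc U hU (a ⊗ₜ[ℝ] tangent (c.coordGerm hc b))).1 =
      a • xA.compVF U hU (c.coordGerm hc b) := by
  have e : a ⊗ₜ[ℝ] (tangent (c.coordGerm hc b) : X.TangentSuperspace x) =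
      a • Algebra.TensorProduct.basis A (c.derBasis hc (X.ev x)) b := by
    rw [Algebra.TensorProduct.basis_apply, SuperChart.derBasis_apply, TensorProduct.smul_tmul',
      smul_eq_mul, mul_one]
    rfl
  rw [e, map_smul, APoint.tensorEquiv, Module.Basis.equiv_apply, Submodule.coe_smul,
    Equiv.refl_apply, APoint.derBasis_coe]

end Supermanifold

end SuperGeom

end

/-! ### The main theorem -/

theorem mainTheorem9 {M : Type u} [TopologicalSpace M] [T2Space M] {p q : ℕ}
    (X : SuperGeom.Supermanifold.{u, v} M p q)
    {A : Type w} [Ring A] [Algebra ℝ A] [SuperGeom.Parity A] [SuperGeom.CommSuperalgebra A]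
    [SuperGeom.SuperWeilAlgebra A] (x : M) (xA : X.APoint x A) :
    -- `Der_{x_A}(𝒪(M), A) ≅ A ⊗ T_x(M)` as left `A`-modules
    Nonempty ((A ⊗[ℝ] X.TangentSuperspace x) ≃ₗ[A] xA.Der ⊤ trivial) ∧
    -- `Der_{x_A}(𝒪(M), A) ≅ A ⊗_{x_A} 𝒯_{M,x}`, through `a ⊗ ξ ↦ a (x_A ∘ ξ)`
    (∃ e : SuperGeom.RhoTensor xA.toAlgHom (SuperGeom.VFGerm X.toSuperSheaf x) ≃ₗ[A]
        xA.Der ⊤ trivial,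
      ∀ (a : A) (ξ : SuperGeom.VFGerm X.toSuperSheaf x),
        (e (Submodule.Quotient.mk (a ⊗ₜ[ℝ] ξ)) : X.obj ⊤ →ₗ[ℝ] A) =
          a • xA.compVF ⊤ trivial ξ) ∧
    -- in a chart `c` around `x`, on any open neighbourhood `U` of `x` (in particular `M` itself)
    ∀ (c : SuperGeom.SuperChart X.toSuperSheaf p q) (hc : x ∈ c.source)
      (U : Opens M) (hU : x ∈ U),
      -- the first identification is `a ⊗ (∂/∂x_i)|_x ↦ a (x_A ∘ ∂/∂x_i)`, and so for `θ_j`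
      (∃ e : (A ⊗[ℝ] X.TangentSuperspace x) ≃ₗ[A] xA.Der U hU,
        (∀ (a : A) (i : Fin p),
          (e (a ⊗ₜ[ℝ] SuperGeom.Supermanifold.tangent
              (SuperGeom.vfGerm X.toSuperSheaf c.source hc (c.dx i))) : X.obj U →ₗ[ℝ] A) =
            a • xA.compVF U hU (SuperGeom.vfGerm X.toSuperSheaf c.source hc (c.dx i))) ∧
        ∀ (a : A) (j : Fin q),
          (e (a ⊗ₜ[ℝ] SuperGeom.Supermanifold.tangent
              (SuperGeom.vfGerm X.toSuperSheaf c.source hc (c.dθ j))) : X.obj U →ₗ[ℝ] A) =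
            a • xA.compVF U hU (SuperGeom.vfGerm X.toSuperSheaf c.source hc (c.dθ j))) ∧
      -- every family `(f, F)` defines an `x_A`-derivation
      (∀ (f : Fin p → A) (F : Fin q → A), xA.coordDer c hc U hU f F ∈ xA.Der U hU) ∧
      -- which is even (odd) iff the `f_i` are even (odd) and the `F_j` are odd (even)
      (∀ (f : Fin p → A) (F : Fin q → A) (k : ZMod 2),
        xA.coordDer c hc U hU f F ∈ SuperGeom.homogDer (xA.on U hU) k ↔
          (∀ i, f i ∈ SuperGeom.Parity.par k) ∧ ∀ j, F j ∈ SuperGeom.Parity.par (k + 1)) ∧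
      -- and every `x_A`-derivation is of this form for a unique family
      ∀ Y ∈ xA.Der U hU, ∃! fF : (Fin p → A) × (Fin q → A),
        Y = xA.coordDer c hc U hU fF.1 fF.2 := by
  have hx := X.mem_chartAt x
  refine ⟨⟨xA.tensorEquiv (X.chartAt x) hx ⊤ trivial⟩,
    ⟨(LinearEquiv.ofBijective _ (SuperGeom.SuperChart.rhoToDer_bijective xA _ hx)).trans
      (xA.derEquiv (X.chartAt x) hx ⊤ trivial), fun a ξ => rfl⟩,
    fun c hc U hU => ⟨⟨xA.tensorEquiv c hc U hU,
      fun a i => xA.tensorEquiv_tmul c hc U hU a (.inl i),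
      fun a j => xA.tensorEquiv_tmul c hc U hU a (.inr j)⟩,
      fun f F => xA.coordDer_eq c hc U hU f F ▸ Subtype.prop _,
      xA.coordDer_mem_homogDer_iff c hc U hU, fun Y hY => ?_⟩⟩
  let e := (xA.derBasis c hc U hU).equivFun
  -- A family representing `Y` is the same as the coordinate vector of `Y` in the basis, so
  -- existence and uniqueness are read off together.
  have key : ∀ fF : (Fin p → A) × (Fin q → A), Y = xA.coordDer c hc U hU fF.1 fF.2 ↔
      e ⟨Y, hY⟩ = Sum.elim fF.1 fF.2 := fun fF => by
    rw [xA.coordDer_eq, ← LinearEquiv.eq_symm_apply, Subtype.ext_iff]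
  refine ⟨(e ⟨Y, hY⟩ ∘ Sum.inl, e ⟨Y, hY⟩ ∘ Sum.inr), (key _).2 (Sum.elim_comp_inl_inr _).symm,
    fun fF h => ?_⟩
  rw [(key fF).1 h]
  rfl
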